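/- Let $m\ge 0$, let $[m]=\{1,\dots,m\}$, and let $K$ be an abstract simplicial complex on the vertex set $[m]$ (with $\emptyset\in K$; not every singleton need be a simplex). Let $(\underline X,\underline A)=\{(X_i,A_i)\}_{i\in[m]}$ be a collection of NDR pairs of pointed spaces with nondegenerate basepoints, i.e. for each $i$ both $(X_i,A_i)$ and $(A_i,*)$ are NDR pairs. Here $(X,A)$ is an NDR pair if there are continuous maps $u\colon X\to[0,1]$ with $A=u^{-1}(0)$ and $h\colon X\times[0,1]\to X$ with $h(x,0)=x$, $h(a,t)=a$ for $a\in A$, and $h(x,1)\in A$ whenever $u(x)<1$. For $\sigma\in K$ put $(\underline X,\underline A)^\sigma=\prod_{i}Y_i$, where $Y_i=X_i$ if $i\in\sigma$ and $Y_i=A_i$ if $i\notin\sigma$. The polyhedral product is the subspace $\mathcal Z_K(\underline X,\underline A)=\bigcup_{\sigma\in K}(\underline X,\underline A)^\sigma$ of $\prod_i X_i$, and, for nonempty vertex sets, the polyhedral smash product $\widehat{\mathcal Z}_K(\underline X,\underline A)$ is the analogous union, over $\sigma\in K$, of the smash products $\bigwedge_i Y_i$ inside $\bigwedge_i X_i$.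 For $I\subset[m]$ let $K_I=\{\sigma\in K\mid\sigma\subset I\}$ and $(\underline X_I,\underline A_I)=\{(X_i,A_i)\}_{i\in I}$. Let $\Sigma$ denote the reduced suspension. Then there is a pointed homotopy equivalence $$\varepsilon_{(\underline X,\underline A)}\colon\ \Sigma\mathcal Z_K(\underline X,\underline A)\ \xrightarrow{\ \simeq\ }\ \Sigma\bigvee_{\emptyset\ne I\subset[m]}\widehat{\mathcal Z}_{K_I}(\underline X_I,\underline A_I)$$ which is natural with respect to $(\underline X,\underline A)$: the maps $\varepsilon$ can be chosen, for all such collections at once, so that for every family of maps of pairs of pointed spaces $f_i\colon(X_i,A_i)\to(X_i',A_i')$, $i\in[m]$, between two such collections, the square formed by $\varepsilon_{(\underline X,\underline A)}$, $\varepsilon_{(\underline X',\underline A')}$ and the maps induced by $(f_i)$ commutes. -/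

import Mathlib

open scoped unitInterval

universe u

/-- A pointed topological space. -/
structure PtdTop : Type (u + 1) where
  carrier : Type u
  [top : TopologicalSpace carrier]
  pt : carrier

namespace PtdTop

instance : CoeSort PtdTop.{u} (Type u) := ⟨PtdTop.carrier⟩

instance (X : PtdTop.{u}) : TopologicalSpace X := X.top

/-- Pointed continuous maps. -/
@[ext]
structure Map (X Y : PtdTop.{u}) : Type u where
  toCont : C(X, Y)
  map_pt : toCont X.pt = Y.pt

namespace Map

variable {X Y Z : PtdTop.{u}}

instance : CoeFun (Map X Y) (fun _ => X → Y) := ⟨fun f => f.toCont⟩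

/-- The identity map. -/
def id (X : PtdTop.{u}) : Map X X := ⟨ContinuousMap.id X, rfl⟩

/-- The composite `g ∘ f`. -/
def comp (g : Map Y Z) (f : Map X Y) : Map X Z :=
  ⟨g.toCont.comp f.toCont, by simp [f.map_pt, g.map_pt]⟩

/-- Pointed homotopy: a homotopy that is constant on the basepoint. -/
def Homotopic (f g : Map X Y) : Prop :=
  ContinuousMap.HomotopicRel f.toCont g.toCont {X.pt}

/-- A pointed map is a (pointed) homotopy equivalence if it has a two-sided inverse
up to pointed homotopy. -/
def IsHomotopyEquiv (f : Map X Y) : Prop :=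
  ∃ g : Map Y X, Homotopic (g.comp f) (Map.id X) ∧ Homotopic (f.comp g) (Map.id Y)

end Map

/-- The subspace of `X` carried by a set `S` that contains the basepoint. -/
def subspace (X : PtdTop.{u}) (S : Set X) (h : X.pt ∈ S) : PtdTop.{u} where
  carrier := S
  pt := ⟨X.pt, h⟩

/-- The restriction of a pointed map to subspaces. -/
def subspaceMap {X Y : PtdTop.{u}} {S : Set X} {T : Set Y} {hS : X.pt ∈ S} {hT : Y.pt ∈ T}
    (f : Map X Y) (hf : ∀ x ∈ S, f x ∈ T) : Map (X.subspace S hS) (Y.subspace T hT) where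
  toCont := ⟨Set.MapsTo.restrict f S T hf, f.toCont.continuous.restrict hf⟩
  map_pt := Subtype.ext f.map_pt

/-- The equivalence relation on `X` that identifies all points of `T ∪ {pt}`. -/
def collapseSetoid (X : PtdTop.{u}) (T : Set X) : Setoid X where
  r x y := x = y ∨ (x = X.pt ∨ x ∈ T) ∧ (y = X.pt ∨ y ∈ T)
  iseqv :=
    { refl := fun _ => Or.inl rfl
      symm := by
        rintro x y (h | ⟨h, h'⟩)
        · exact Or.inl h.symm
        · exact Or.inr ⟨h', h⟩
      trans := by
        rintro x y z (rfl | ⟨h, h'⟩) (rfl | ⟨k, k'⟩)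
        · exact Or.inl rfl
        · exact Or.inr ⟨k, k'⟩
        · exact Or.inr ⟨h, h'⟩
        · exact Or.inr ⟨h, k'⟩ }

/-- The quotient space `X / (T ∪ {pt})`, with the quotient topology; its basepoint is the
class of the basepoint of `X`, to which all of `T` is collapsed. -/
def collapse (X : PtdTop.{u}) (T : Set X) : PtdTop.{u} where
  carrier := Quotient (X.collapseSetoid T)
  pt := Quotient.mk _ X.pt

/-- The quotient map `X → X / (T ∪ {pt})`. -/
def collapseMk (X : PtdTop.{u}) (T : Set X) : Map X (X.collapse T) where
  toCont := ⟨Quotient.mk (X.collapseSetoid T), continuous_quot_mk⟩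
  map_pt := rfl

/-- The map of quotient spaces induced by a pointed map. -/
def collapseMap {X Y : PtdTop.{u}} {S : Set X} {T : Set Y} (f : Map X Y)
    (hf : ∀ x ∈ S, f x ∈ T) : Map (X.collapse S) (Y.collapse T) where
  toCont :=
    { toFun := Quotient.map f (by
        have key : ∀ x : X, x = X.pt ∨ x ∈ S → f x = Y.pt ∨ f x ∈ T := by
          rintro x (rfl | h)
          · exact Or.inl f.map_pt
          · exact Or.inr (hf x h)
        rintro x y (rfl | ⟨h, h'⟩)
        · exact Or.inl rfl
        · exact Or.inr ⟨key x h, key y h'⟩)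
      continuous_toFun := f.toCont.continuous.quotient_map' _ }
  map_pt := congrArg (Quotient.mk (Y.collapseSetoid T)) f.map_pt

/-- The cylinder `X × [0,1]`, with basepoint `(pt, 0)`. -/
def cylinder (X : PtdTop.{u}) : PtdTop.{u} where
  carrier := X × I
  pt := (X.pt, 0)

/-- The (reduced) suspension `ΣX = (X × [0,1]) / (X × {0,1} ∪ {pt} × [0,1])`. -/
def susp (X : PtdTop.{u}) : PtdTop.{u} :=
  X.cylinder.collapse {p : X × I | p.1 = X.pt ∨ p.2 = 0 ∨ p.2 = 1}

/-- The suspension of a pointed map. -/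
def suspMap {X Y : PtdTop.{u}} (f : Map X Y) : Map X.susp Y.susp :=
  collapseMap
    { toCont := f.toCont.prodMap (ContinuousMap.id I)
      map_pt := Prod.ext f.map_pt rfl }
    (by
      rintro ⟨x, t⟩ (h | h)
      · exact Or.inl ((congrArg f h).trans f.map_pt)
      · exact Or.inr h)

section families

variable {ι : Type} {X Y : ι → PtdTop.{u}}

/-- The disjoint union of a family of pointed spaces and a further basepoint. -/
def disjUnion (X : ι → PtdTop.{u}) : PtdTop.{u} where
  carrier := PUnit.{u + 1} ⊕ (Σ i, X i)
  pt := Sum.inl PUnit.unit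

/-- The wedge sum `⋁ᵢ Xᵢ`: the disjoint union with all basepoints identified.
It is a point if `ι` is empty. -/
def wedge (X : ι → PtdTop.{u}) : PtdTop.{u} :=
  (disjUnion X).collapse (Set.range fun i => Sum.inr ⟨i, (X i).pt⟩)

/-- The map of wedge sums induced by a family of pointed maps. -/
def wedgeMap (f : ∀ i, Map (X i) (Y i)) : Map (wedge X) (wedge Y) :=
  collapseMap
    { toCont :=
        { toFun := Sum.map _root_.id (Sigma.map _root_.id fun i => f i)
          continuous_toFun := continuous_id.sumMap
            (Continuous.sigma_map fun i => (f i).toCont.continuous) }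
      map_pt := rfl }
    (by
      rintro _ ⟨i, rfl⟩
      exact ⟨i, congrArg (fun y : Y i => (Sum.inr ⟨i, y⟩ : PUnit.{u + 1} ⊕ (Σ i, Y i)))
        (f i).map_pt.symm⟩)

/-- The product `∏ᵢ Xᵢ`. -/
def prod (X : ι → PtdTop.{u}) : PtdTop.{u} where
  carrier := ∀ i, X i
  pt := fun i => (X i).pt

/-- The map of products induced by a family of pointed maps. -/
def prodMap (f : ∀ i, Map (X i) (Y i)) : Map (prod X) (prod Y) where
  toCont :=
    { toFun := fun x i => f i (x i)
      continuous_toFun :=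
        continuous_pi fun i => (f i).toCont.continuous.comp (continuous_apply i) }
  map_pt := funext fun i => (f i).map_pt

/-- The fat wedge in `∏ᵢ Xᵢ`: the points with some coordinate at the basepoint. -/
def fatWedge (X : ι → PtdTop.{u}) : Set (prod X) :=
  {x | ∃ i, x i = (X i).pt}

/-- The smash product `⋀ᵢ Xᵢ` of a nonempty family: the product with its fat wedge
collapsed. -/
def smash (X : ι → PtdTop.{u}) : PtdTop.{u} := (prod X).collapse (fatWedge X)

/-- The quotient map `∏ᵢ Xᵢ → ⋀ᵢ Xᵢ`. -/
def smashMk (X : ι → PtdTop.{u}) : Map (prod X) (smash X) := collapseMk _ _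

/-- The map of smash products induced by a family of pointed maps. -/
def smashMap (f : ∀ i, Map (X i) (Y i)) : Map (smash X) (smash Y) :=
  collapseMap (prodMap f) (by
    rintro x ⟨i, hi⟩
    exact ⟨i, (congrArg (f i) hi).trans (f i).map_pt⟩)

end families

end PtdTop

/-- `(X, A)` is an NDR pair: there are `u : X → [0,1]` with `A = u⁻¹(0)` and a homotopy
`h : X × [0,1] → X` rel `A`, starting at the identity, with `h(x, 1) ∈ A` if `u(x) < 1`. -/
def IsNDRPair {X : Type u} [TopologicalSpace X] (A : Set X) : Prop :=
  ∃ (v : C(X, I)) (h : C(X × I, X)),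
    (∀ x, x ∈ A ↔ v x = 0) ∧
    (∀ x, h (x, 0) = x) ∧
    (∀ a ∈ A, ∀ t, h (a, t) = a) ∧
    (∀ x, v x < 1 → h (x, 1) ∈ A)

/-- A pair of pointed spaces `(X, A)`: a subspace `A` of `X` that contains the basepoint. -/
structure PtdPair : Type (u + 1) extends PtdTop.{u} where
  sub : Set carrier
  pt_mem : pt ∈ sub

namespace PtdPair

/-- The pointed space `A` of a pair `(X, A)`. -/
def subTop (P : PtdPair.{u}) : PtdTop.{u} := P.toPtdTop.subspace P.sub P.pt_mem

/-- NDR pairs of pointed spaces: `(X, A)` is an NDR pair and the basepoint is nondegenerate,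
that is, `(A, pt)` is an NDR pair too. -/
structure IsNDR (P : PtdPair.{u}) : Prop where
  pair : IsNDRPair (X := P.toPtdTop) P.sub
  pt : IsNDRPair (X := P.subTop) {P.subTop.pt}

/-- Maps of pairs of pointed spaces. -/
structure Map (P Q : PtdPair.{u}) : Type u extends PtdTop.Map P.toPtdTop Q.toPtdTop where
  map_sub : ∀ x ∈ P.sub, toCont x ∈ Q.sub

end PtdPair

section polyhedral

variable {ι : Type}

/-- The simplices of an abstract simplicial complex, the empty simplex included
(Mathlib lists only the nonempty ones). -/
def PreAbstractSimplicialComplex.IsSimplex (K : PreAbstractSimplicialComplex ι)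
    (s : Finset ι) : Prop :=
  s = ∅ ∨ s ∈ K

/-- The full subcomplex `K_I = {s ⊆ I | s ∈ K}`, as a complex on the set `I`. -/
def PreAbstractSimplicialComplex.restrict (K : PreAbstractSimplicialComplex ι)
    (J : Finset ι) : PreAbstractSimplicialComplex J where
  faces := {s | s.map (Function.Embedding.subtype _) ∈ K}
  isRelLowerSet_faces := by
    intro s hs
    refine ⟨by simpa using (K.isRelLowerSet_faces hs).1, fun τ hτ hne => ?_⟩
    exact (K.isRelLowerSet_faces hs).2 (Finset.map_subset_map.2 hτ) (by simpa using hne)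

variable (K : PreAbstractSimplicialComplex ι)

/-- The product `(X, A)^s = ∏ᵢ Yᵢ`, where `Yᵢ = Xᵢ` for `i ∈ s` and `Yᵢ = Aᵢ` for `i ∉ s`. -/
def pairPower (P : ι → PtdPair.{u}) (s : Finset ι) :
    Set (PtdTop.prod fun i => (P i).toPtdTop) :=
  {x | ∀ i, i ∉ s → x i ∈ (P i).sub}

/-- The polyhedral product `Z_K(X, A)`, the union of the `(X, A)^s` over the simplices `s`
of `K`, as a subspace of `∏ᵢ Xᵢ`. -/
def polyProd (P : ι → PtdPair.{u}) : PtdTop.{u} :=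
  (PtdTop.prod fun i => (P i).toPtdTop).subspace
    (⋃ (s : Finset ι) (_ : K.IsSimplex s), pairPower P s)
    (Set.mem_iUnion₂.2 ⟨∅, Or.inl rfl, fun i _ => (P i).pt_mem⟩)

/-- The polyhedral smash product: the union, over the simplices `s` of `K`, of the smash
products `⋀ᵢ Yᵢ` (`Yᵢ = Xᵢ` for `i ∈ s` and `Yᵢ = Aᵢ` for `i ∉ s`), as a subspace
of `⋀ᵢ Xᵢ`. -/
def polySmash (P : ι → PtdPair.{u}) : PtdTop.{u} :=
  (PtdTop.smash fun i => (P i).toPtdTop).subspace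
    (⋃ (s : Finset ι) (_ : K.IsSimplex s),
      PtdTop.smashMk (fun i => (P i).toPtdTop) '' pairPower P s)
    (Set.mem_iUnion₂.2 ⟨∅, Or.inl rfl, _, fun i _ => (P i).pt_mem, rfl⟩)

variable {P Q : ι → PtdPair.{u}}

theorem pairPower_map (f : ∀ i, PtdPair.Map (P i) (Q i)) {s : Finset ι}
    {x : PtdTop.prod fun i => (P i).toPtdTop} (hx : x ∈ pairPower P s) :
    PtdTop.prodMap (fun i => (f i).toMap) x ∈ pairPower Q s :=
  fun i hi => (f i).map_sub _ (hx i hi)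

/-- The map of polyhedral products induced by a family of maps of pairs. -/
def polyProdMap (f : ∀ i, PtdPair.Map (P i) (Q i)) :
    PtdTop.Map (polyProd K P) (polyProd K Q) :=
  PtdTop.subspaceMap (PtdTop.prodMap fun i => (f i).toMap) (by
    intro x hx
    obtain ⟨s, hs, hx⟩ := Set.mem_iUnion₂.1 hx
    exact Set.mem_iUnion₂.2 ⟨s, hs, pairPower_map f hx⟩)

/-- The map of polyhedral smash products induced by a family of maps of pairs. -/
def polySmashMap (f : ∀ i, PtdPair.Map (P i) (Q i)) :
    PtdTop.Map (polySmash K P) (polySmash K Q) :=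
  PtdTop.subspaceMap (PtdTop.smashMap fun i => (f i).toMap) (by
    intro x hx
    obtain ⟨s, hs, y, hy, rfl⟩ := Set.mem_iUnion₂.1 hx
    exact Set.mem_iUnion₂.2 ⟨s, hs, _, pairPower_map f hy, rfl⟩)

/-- The wedge `⋁_{∅ ≠ I ⊆ [m]}` of the polyhedral smash products of the pairs indexed by `I`
over the full subcomplexes `K_I`. -/
def wedgePolySmash {m : ℕ} (K : PreAbstractSimplicialComplex (Fin m))
    (P : Fin m → PtdPair.{u}) : PtdTop.{u} :=
  PtdTop.wedge fun J : {J : Finset (Fin m) // J.Nonempty} =>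
    polySmash (K.restrict J.1) (fun i : J.1 => P i)

/-- The map of these wedges induced by a family of maps of pairs. -/
def wedgePolySmashMap {m : ℕ} (K : PreAbstractSimplicialComplex (Fin m))
    {P Q : Fin m → PtdPair.{u}} (f : ∀ i, PtdPair.Map (P i) (Q i)) :
    PtdTop.Map (wedgePolySmash K P) (wedgePolySmash K Q) :=
  PtdTop.wedgeMap fun J => polySmashMap (K.restrict J.1) (fun i : J.1 => f i)

end polyhedral

/-! The map ε is the sum, in the co-H-structure of the suspension and in a fixed order of the
subsets J of [m], of the suspensions of the composites Z_K → Z_{K_J} → smash over K_J → wedge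
(`polyProd.toWedge`). This formula does not involve the NDR data, so naturality holds strictly
(`PtdTop.suspSum_natural`). The NDR data serve only to prove that ε is an equivalence.

By a Yoneda argument (`PtdTop.Map.isHomotopyEquiv_of_bijective`) it suffices that precomposition
with ε is bijective on pointed homotopy classes of maps to every pointed space T. By adjunction,
classes of maps ΣX → T are classes of families of loops in T parametrized by X and constant over the
basepoint. They form a group `LoopClass`, in general not abelian, and precomposition with ε sends γ
to the ordered product of its pullbacks along the maps `toWedge K P J`.

On the group G of Z_K, moving coordinate i to the basepoint induces commuting idempotent
endomorphisms r_i. Pure group theory then shows that each g in G is in exactly one way an ordered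
product of elements c_J such that r_i kills c_J for i in J and fixes it for i not in J
(`exists_isHomogeneous_prod`, `isHomogeneous_prod_unique`). The component c_∅ is trivial, because
moving all coordinates gives a constant map.

It remains to identify the elements of type J with the loop classes of the smash product over K_J.
Being fixed by r_i for i outside J means coming from Z_{K_J}. Being killed by r_i for i in J means,
by the NDR hypotheses, coming in a unique way from a family that is constant over the whole fat
wedge (`polyProd.pullback_fat`), hence from the smash product (`polyProd.loopClass_polySmash`). The
key point of homotopy theory is that the subspace where coordinate i is the basepoint is both a
retract and a neighbourhood deformation retract, so relative classes inject into absolute ones with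
image the kernel of restriction. -/

/-! ### Homotopies of loops that depend continuously on the loop -/

/-- Two maps that agree on `S` are homotopic relative to `S` as soon as there is a homotopy,
in curried form, that is stationary on `S`. -/
theorem ContinuousMap.HomotopicRel.of_curried {X Y : Type*} [TopologicalSpace X]
    [TopologicalSpace Y] {f g : C(X, Y)} {S : Set X} (H : I → X → Y)
    (hH : Continuous fun p : I × X => H p.1 p.2) (h0 : ∀ x, H 0 x = f x) (h1 : ∀ x, H 1 x = g x)
    (hS : ∀ s, ∀ x ∈ S, H s x = f x) : f.HomotopicRel g S :=
  ⟨{ toFun := fun p => H p.1 p.2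
     continuous_toFun := hH
     map_zero_left := h0
     map_one_left := h1
     prop' := hS }⟩

theorem ContinuousMap.HomotopicRel.exists_curried {X Y : Type*} [TopologicalSpace X]
    [TopologicalSpace Y] {f g : C(X, Y)} {S : Set X} (h : f.HomotopicRel g S) :
    ∃ H : I → X → Y, Continuous (fun p : I × X => H p.1 p.2) ∧ (∀ x, H 0 x = f x) ∧
      (∀ x, H 1 x = g x) ∧ ∀ s, ∀ x ∈ S, H s x = f x := by
  obtain ⟨H⟩ := h
  exact ⟨fun s x => H (s, x), H.continuous, fun x => H.map_zero_left x, fun x => H.map_one_left x,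
    fun s x hx => H.eq_fst s hx⟩

namespace Path

variable {T : Type*} [TopologicalSpace T] {t : T}

/-- A path is homotopic to its reparametrizations, by a homotopy that depends continuously
on the path. -/
theorem exists_homotopy_reparam (α : I → I) (hα : Continuous α) (h0 : α 0 = 0) (h1 : α 1 = 1) :
    ∃ H : I → Path t t → Path t t, Continuous (fun q : I × Path t t => H q.1 q.2) ∧
      (∀ p, H 0 p = p.reparam α hα h0 h1) ∧ (∀ p, H 1 p = p) ∧
      ∀ s, H s (Path.refl t) = Path.refl t := by
  refine ⟨fun s p => (Homotopy.reparam p α hα h0 h1).symm.eval s, ?_, fun p => by simp,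
    fun p => by simp, fun s => ?_⟩
  · rw [← continuous_uncurry_iff]
    change Continuous fun q : (I × Path t t) × I => q.1.2 ⟨_, _⟩
    fun_prop
  · ext u
    rfl

/-- The concatenation of a path and its inverse is null homotopic, by a homotopy that depends
continuously on the path. -/
theorem exists_homotopy_trans_symm :
    ∃ H : I → Path t t → Path t t, Continuous (fun q : I × Path t t => H q.1 q.2) ∧
      (∀ p, H 0 p = p.trans p.symm) ∧ (∀ p, H 1 p = Path.refl t) ∧
      ∀ s, H s (Path.refl t) = Path.refl t := by
  refine ⟨fun s p => (Homotopy.reflTransSymm p).symm.eval s, ?_, fun p => by simp,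
    fun p => by simp, fun s => ?_⟩
  · rw [← continuous_uncurry_iff]
    change Continuous fun q : (I × Path t t) × I => q.1.2 ⟨_, _⟩
    fun_prop
  · ext u
    rfl

end Path

theorem ContinuousMap.mapsTo_id_of_subset {X : Type*} [TopologicalSpace X] {F F' : Set X}
    (h : F ⊆ F') : Set.MapsTo (ContinuousMap.id X) F F' := h

/-! ### The group of homotopy classes of families of loops -/

section LoopClass

variable {X Y Z T : Type*} [TopologicalSpace X] [TopologicalSpace Y] [TopologicalSpace Z]
  [TopologicalSpace T]

/-- Continuous families of loops at `t` that are constant over `F`. -/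
structure LoopFamily (F : Set X) (t : T) where
  /-- The underlying continuous map. -/
  toCont : C(X, Path t t)
  eq_refl : ∀ x ∈ F, toCont x = Path.refl t

namespace LoopFamily

variable {F : Set X} {F' : Set Y} {t : T}

instance : CoeFun (LoopFamily F t) (fun _ => X → Path t t) := ⟨fun φ => φ.toCont⟩

/-- A loop family from a continuous function. -/
def of (f : X → Path t t) (hf : Continuous f) (hF : ∀ x ∈ F, f x = Path.refl t) :
    LoopFamily F t := ⟨⟨f, hf⟩, hF⟩

theorem continuous (φ : LoopFamily F t) : Continuous φ := φ.toCont.continuous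

@[ext]
theorem ext {φ ψ : LoopFamily F t} (h : ∀ x, φ x = ψ x) : φ = ψ := by
  obtain ⟨φ, hφ⟩ := φ
  obtain ⟨ψ, hψ⟩ := ψ
  obtain rfl : φ = ψ := ContinuousMap.ext h
  rfl

instance : One (LoopFamily F t) := ⟨of (fun _ => Path.refl t) continuous_const fun _ _ => rfl⟩

noncomputable instance : Mul (LoopFamily F t) :=
  ⟨fun φ ψ => of (fun x => (φ x).trans (ψ x)) (φ.continuous.path_trans ψ.continuous)
    fun x hx => by rw [φ.eq_refl x hx, ψ.eq_refl x hx, Path.refl_trans_refl]⟩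

instance : Inv (LoopFamily F t) :=
  ⟨fun φ => of (fun x => (φ x).symm) (Path.continuous_symm.comp φ.continuous)
    fun x hx => by rw [φ.eq_refl x hx, Path.refl_symm]⟩

theorem one_apply (x : X) : (1 : LoopFamily F t) x = Path.refl t := rfl

theorem mul_apply (φ ψ : LoopFamily F t) (x : X) : (φ * ψ) x = (φ x).trans (ψ x) := rfl

theorem inv_apply (φ : LoopFamily F t) (x : X) : φ⁻¹ x = (φ x).symm := rfl

/-- Homotopy of loop families, through loop families that are constant over `F`. -/
instance setoid (F : Set X) (t : T) : Setoid (LoopFamily F t) where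
  r φ ψ := ContinuousMap.HomotopicRel φ.toCont ψ.toCont F
  iseqv := ⟨fun _ => .refl _, fun h => .symm h, fun h k => .trans h k⟩

theorem equiv_of_curried {φ ψ : LoopFamily F t} (H : I → X → Path t t)
    (hH : Continuous fun p : I × X => H p.1 p.2) (h0 : ∀ x, H 0 x = φ x) (h1 : ∀ x, H 1 x = ψ x)
    (hS : ∀ s, ∀ x ∈ F, H s x = Path.refl t) : φ ≈ ψ :=
  ContinuousMap.HomotopicRel.of_curried H hH h0 h1
    fun s x hx => (hS s x hx).trans (φ.eq_refl x hx).symm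

theorem exists_curried {φ ψ : LoopFamily F t} (h : φ ≈ ψ) :
    ∃ H : I → X → Path t t, Continuous (fun p : I × X => H p.1 p.2) ∧ (∀ x, H 0 x = φ x) ∧
      (∀ x, H 1 x = ψ x) ∧ ∀ s, ∀ x ∈ F, H s x = Path.refl t := by
  obtain ⟨H, h1, h2, h3, h4⟩ := ContinuousMap.HomotopicRel.exists_curried h
  exact ⟨H, h1, h2, h3, fun s x hx => (h4 s x hx).trans (φ.eq_refl x hx)⟩

theorem mul_equiv {φ φ' ψ ψ' : LoopFamily F t} (h : φ ≈ φ') (k : ψ ≈ ψ') :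
    φ * ψ ≈ φ' * ψ' := by
  obtain ⟨H, hc, h0, h1, hF⟩ := exists_curried h
  obtain ⟨K, kc, k0, k1, kF⟩ := exists_curried k
  refine equiv_of_curried (fun s x => (H s x).trans (K s x)) (hc.path_trans kc) ?_ ?_ ?_
  · intro x
    rw [h0, k0, mul_apply]
  · intro x
    rw [h1, k1, mul_apply]
  · intro s x hx
    rw [hF s x hx, kF s x hx, Path.refl_trans_refl]

theorem inv_equiv {φ φ' : LoopFamily F t} (h : φ ≈ φ') : φ⁻¹ ≈ φ'⁻¹ := by
  obtain ⟨H, hc, h0, h1, hF⟩ := exists_curried h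
  refine equiv_of_curried (fun s x => (H s x).symm) (Path.continuous_symm.comp hc) ?_ ?_ ?_
  · intro x
    rw [h0, inv_apply]
  · intro x
    rw [h1, inv_apply]
  · intro s x hx
    rw [hF s x hx, Path.refl_symm]

/-- A homotopy of loops that depends continuously on the loop gives a homotopy of families. -/
theorem equiv_of_path_homotopy (φ : LoopFamily F t) {ψ χ : LoopFamily F t}
    (H : I → Path t t → Path t t) (hH : Continuous fun q : I × Path t t => H q.1 q.2)
    (h0 : ∀ x, H 0 (φ x) = ψ x) (h1 : ∀ x, H 1 (φ x) = χ x)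
    (hr : ∀ s, H s (Path.refl t) = Path.refl t) : ψ ≈ χ := by
  have hφ := φ.continuous
  exact equiv_of_curried (fun s x => H s (φ x))
    (hH.comp (continuous_fst.prodMk (hφ.comp continuous_snd))) h0 h1
    fun s x hx => by rw [φ.eq_refl _ hx, hr]

/-- One bracketing is a reparametrization of the other, by a map of the interval that does not
depend on the loops. The homotopy is therefore continuous in the parameter and fixes the constant
loop, so it stays constant over `F`. -/
theorem mul_assoc_equiv (φ ψ χ : LoopFamily F t) : φ * ψ * χ ≈ φ * (ψ * χ) := by
  obtain ⟨H, hH, h0, h1, hr⟩ := Path.exists_homotopy_reparam (t := t)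
    (fun t => ⟨Path.Homotopy.transAssocReparamAux t, Path.Homotopy.transAssocReparamAux_mem_I t⟩)
    (by fun_prop) (Subtype.ext Path.Homotopy.transAssocReparamAux_zero)
    (Subtype.ext Path.Homotopy.transAssocReparamAux_one)
  refine equiv_of_path_homotopy (φ * (ψ * χ)) H hH (fun x => ?_) (fun _ => h1 _) hr
  rw [h0]
  exact (Path.Homotopy.trans_assoc_reparam _ _ _).symm

theorem mul_one_equiv (φ : LoopFamily F t) : φ * 1 ≈ φ := by
  obtain ⟨H, hH, h0, h1, hr⟩ := Path.exists_homotopy_reparam (t := t)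
    (fun t => ⟨Path.Homotopy.transReflReparamAux t, Path.Homotopy.transReflReparamAux_mem_I t⟩)
    (by fun_prop) (Subtype.ext Path.Homotopy.transReflReparamAux_zero)
    (Subtype.ext Path.Homotopy.transReflReparamAux_one)
  refine equiv_of_path_homotopy φ H hH (fun x => ?_) (fun _ => h1 _) hr
  rw [h0]
  exact (Path.Homotopy.trans_refl_reparam _).symm

theorem mul_inv_equiv (φ : LoopFamily F t) : φ * φ⁻¹ ≈ 1 := by
  obtain ⟨H, hH, h0, h1, hr⟩ := Path.exists_homotopy_trans_symm (t := t)
  exact equiv_of_path_homotopy φ H hH (fun _ => h0 _) (fun _ => h1 _) hr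

/-- The pullback of a loop family. -/
def pullback (f : C(X, Y)) (hf : Set.MapsTo f F F') (φ : LoopFamily F' t) : LoopFamily F t :=
  of (fun x => φ (f x)) (φ.continuous.comp f.continuous) fun _ hx => φ.eq_refl _ (hf hx)

theorem pullback_apply (f : C(X, Y)) (hf : Set.MapsTo f F F') (φ : LoopFamily F' t) (x : X) :
    φ.pullback f hf x = φ (f x) := rfl

theorem pullback_equiv (f : C(X, Y)) (hf : Set.MapsTo f F F') {φ ψ : LoopFamily F' t}
    (h : φ ≈ ψ) : φ.pullback f hf ≈ ψ.pullback f hf := by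
  obtain ⟨H, hc, h0, h1, hF⟩ := exists_curried h
  exact equiv_of_curried (fun s x => H s (f x))
    (hc.comp (continuous_fst.prodMk (f.continuous.comp continuous_snd)))
    (fun _ => h0 _) (fun _ => h1 _) fun s x hx => hF s _ (hf hx)

end LoopFamily

/-- Homotopy classes of families of loops at `t`, parametrized by `X` and constant over `F`. -/
def LoopClass (F : Set X) (t : T) : Type _ := Quotient (LoopFamily.setoid F t)

namespace LoopClass

variable {F : Set X} {F' : Set Y} {F'' : Set Z} {t : T}

/-- The class of a loop family. -/
def mk (φ : LoopFamily F t) : LoopClass F t := Quotient.mk _ φ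

theorem mk_eq_mk {φ ψ : LoopFamily F t} : mk φ = mk ψ ↔ φ ≈ ψ := Quotient.eq

theorem mk_surjective : Function.Surjective (mk : LoopFamily F t → LoopClass F t) :=
  Quotient.mk_surjective

instance : One (LoopClass F t) := ⟨mk 1⟩

noncomputable instance : Mul (LoopClass F t) :=
  ⟨Quotient.map₂ (· * ·) fun _ _ h _ _ k => LoopFamily.mul_equiv h k⟩

instance : Inv (LoopClass F t) := ⟨Quotient.map (·⁻¹) fun _ _ h => LoopFamily.inv_equiv h⟩

noncomputable instance : Group (LoopClass F t) :=
  Group.ofRightAxioms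
    (by
      rintro ⟨φ⟩ ⟨ψ⟩ ⟨χ⟩
      exact Quotient.sound (φ.mul_assoc_equiv ψ χ))
    (by
      rintro ⟨φ⟩
      exact Quotient.sound φ.mul_one_equiv)
    (by
      rintro ⟨φ⟩
      exact Quotient.sound φ.mul_inv_equiv)

theorem mk_one : mk (1 : LoopFamily F t) = 1 := rfl

/-- The pullback homomorphism along a continuous map of pairs. -/
noncomputable def pullback (f : C(X, Y)) (hf : Set.MapsTo f F F') : LoopClass F' t →* LoopClass F t where
  toFun := Quotient.map (fun φ => φ.pullback f hf) fun _ _ h => LoopFamily.pullback_equiv f hf h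
  map_one' := rfl
  map_mul' := by
    rintro ⟨φ⟩ ⟨ψ⟩
    rfl

theorem pullback_mk (f : C(X, Y)) (hf : Set.MapsTo f F F') (φ : LoopFamily F' t) :
    pullback f hf (mk φ) = mk (φ.pullback f hf) := rfl

/-- A pullback along a map with image in `F'` is trivial. -/
theorem pullback_eq_one (f : C(X, Y)) (hf : Set.MapsTo f F F') (h : ∀ x, f x ∈ F')
    (γ : LoopClass F' t) : pullback f hf γ = 1 := by
  obtain ⟨φ, rfl⟩ := mk_surjective γ
  rw [pullback_mk, ← mk_one]
  congr 1
  ext1 x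
  exact φ.eq_refl _ (h x)

theorem pullback_pullback (f : C(X, Y)) (hf : Set.MapsTo f F F') (g : C(Y, Z))
    (hg : Set.MapsTo g F' F'') (h : C(X, Z)) (hh : Set.MapsTo h F F'') (e : ∀ x, g (f x) = h x)
    (γ : LoopClass F'' t) : pullback f hf (pullback g hg γ) = pullback h hh γ := by
  obtain ⟨φ, rfl⟩ := mk_surjective γ
  simp only [pullback_mk]
  congr 1
  ext1 x
  simp only [LoopFamily.pullback_apply, e]

theorem pullback_of_eq_id (f : C(X, X)) (hf : Set.MapsTo f F F) (e : ∀ x, f x = x)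
    (γ : LoopClass F t) : pullback f hf γ = γ := by
  obtain ⟨φ, rfl⟩ := mk_surjective γ
  rw [pullback_mk]
  congr 1
  ext1 x
  rw [LoopFamily.pullback_apply, e]

end LoopClass

end LoopClass

/-! ### Relative and absolute loop classes for a split cofibration -/

section SplitCofibration

variable {X T : Type*} [TopologicalSpace X] [TopologicalSpace T]

/-- Data that present the image of an idempotent `r` as a neighbourhood deformation retract,
by a deformation of `X` that is compatible with `r`. -/
structure NDRRetraction (r : C(X, X)) where
  /-- The deformation. -/
  D : I → X → X
  continuous_D : Continuous fun p : I × X => D p.1 p.2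
  D_zero : ∀ x, D 0 x = x
  retract_D : ∀ s x, r (D s x) = r x
  D_retract : ∀ s x, D s (r x) = r x
  retract_retract : ∀ x, r (r x) = r x
  /-- The function that cuts out the image of `r`. -/
  w : C(X, I)
  D_one : ∀ x, w x < 1 → D 1 x = r x
  w_eq_zero : ∀ x, w x = 0 ↔ r x = x

namespace NDRRetraction

variable {r : C(X, X)} (R : NDRRetraction r) {F : Set X} {t : T}

/-- The parameter `1 - 2w`, cut off at `0`. -/
noncomputable def cutoff (x : X) : I := Set.projIcc 0 1 zero_le_one (1 - 2 * (R.w x : ℝ))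

theorem continuous_cutoff : Continuous R.cutoff := by
  unfold cutoff
  fun_prop

theorem cutoff_of_fixed {x : X} (h : r x = x) : R.cutoff x = 1 := by
  simp [cutoff, (R.w_eq_zero x).2 h]

theorem cutoff_of_half {x : X} (h : (R.w x : ℝ) = 1 / 2) : R.cutoff x = 0 := by
  simp [cutoff, h]

theorem D_one_of_le {x : X} (h : (R.w x : ℝ) ≤ 1 / 2) : R.D 1 x = r x :=
  R.D_one x (Subtype.coe_lt_coe.1 (h.trans_lt (by norm_num)))

theorem w_of_fixed {x : X} (h : r x = x) : (R.w x : ℝ) ≤ 1 / 2 := by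
  simp [(R.w_eq_zero x).2 h]

theorem D_of_fixed {x : X} (h : r x = x) (s : I) : R.D s x = x := by
  rw [← h, R.D_retract]

theorem continuous_D_one : Continuous (R.D 1) :=
  R.continuous_D.comp (continuous_const.prodMk continuous_id)

include R in
theorem retract_mem {x : X} : r x ∈ {y | r y = y} := R.retract_retract x

/-- Loop families are homotopic to their composites with the end of the deformation. -/
theorem comp_D_one_equiv (hF : ∀ s, Set.MapsTo (R.D s) F F) (φ : LoopFamily F t) :
    φ.pullback ⟨R.D 1, R.continuous_D_one⟩ (hF 1) ≈ φ :=
  Setoid.symm <| LoopFamily.equiv_of_curried (fun s x => φ (R.D s x))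
    (φ.continuous.comp R.continuous_D) (fun x => by rw [R.D_zero])
    (fun _ => rfl) fun s x hx => φ.eq_refl _ (hF s hx)

/-- A loop family that is null homotopic on the image of `r` can be deformed to one that is
constant there. -/
theorem exists_lift (hF : ∀ s, Set.MapsTo (R.D s) F F) (hr : Set.MapsTo r F F)
    (φ : LoopFamily F t) (h : φ.pullback r hr ≈ 1) :
    ∃ ψ : LoopFamily (F ∪ {x | r x = x}) t,
      ψ.pullback (ContinuousMap.id X)
      (ContinuousMap.mapsTo_id_of_subset Set.subset_union_left) ≈ φ := by
  obtain ⟨N, hN, h0, h1, hNF⟩ := LoopFamily.exists_curried h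
  have hw := R.w.continuous
  have hc := R.continuous_cutoff
  -- Near the image of `r` the new family follows the null homotopy `N` up to the time `cutoff`,
  -- which is 1 on the image; elsewhere it is φ composed with `D 1`. Where w = 1/2 the time is 0 and
  -- both formulas give φ ∘ r. The factor `p.1` scales the time, which yields the homotopy back to φ
  -- composed with `D 1`.
  have key : Continuous fun p : I × X =>
      if (R.w p.2 : ℝ) ≤ 1 / 2 then N (p.1 * R.cutoff p.2) (r p.2) else φ (R.D 1 p.2) := by
    refine Continuous.if_le ?_ ?_ (by fun_prop) continuous_const ?_
    · exact hN.comp (by fun_prop : Continuous fun p : I × X => (p.1 * R.cutoff p.2, r p.2))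
    · exact φ.continuous.comp (R.continuous_D_one.comp continuous_snd)
    · intro p hp
      rw [R.cutoff_of_half hp, mul_zero, h0, R.D_one_of_le hp.le, LoopFamily.pullback_apply,
        R.retract_retract]
  have hrF : ∀ s, ∀ x ∈ F,
      (if (R.w x : ℝ) ≤ 1 / 2 then N (s * R.cutoff x) (r x) else φ (R.D 1 x)) =
        Path.refl t := by
    intro s x hx
    split_ifs
    · exact hNF _ _ (hr hx)
    · exact φ.eq_refl _ (hF 1 hx)
  refine ⟨LoopFamily.of (fun x => if (R.w x : ℝ) ≤ 1 / 2 then N (1 * R.cutoff x) (r x)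
    else φ (R.D 1 x)) (key.comp (continuous_const.prodMk continuous_id)) ?_, ?_⟩
  · rintro x (hx | hx)
    · exact hrF 1 x hx
    · rw [if_pos (R.w_of_fixed hx), R.cutoff_of_fixed hx, mul_one, h1]
      rfl
  · refine Setoid.trans (Setoid.symm ?_) (R.comp_D_one_equiv hF φ)
    refine LoopFamily.equiv_of_curried (fun s x => if (R.w x : ℝ) ≤ 1 / 2 then N (s * R.cutoff x) (r x)
      else φ (R.D 1 x)) key (fun x => ?_) (fun x => rfl) hrF
    split_ifs with hx
    · rw [zero_mul, h0, LoopFamily.pullback_apply, LoopFamily.pullback_apply, R.retract_retract]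
      exact congrArg φ (R.D_one_of_le hx).symm
    · rfl

/-- A loop family that is constant on the image of `r` and null homotopic is null homotopic
relative to the image of `r`. -/
theorem equiv_one (hF : ∀ s, Set.MapsTo (R.D s) F F) (hr : Set.MapsTo r F F)
    (φ : LoopFamily (F ∪ {x | r x = x}) t)
    (h : φ.pullback (ContinuousMap.id X)
      (ContinuousMap.mapsTo_id_of_subset Set.subset_union_left) ≈ (1 : LoopFamily F t)) :
    φ ≈ 1 := by
  obtain ⟨N, hN, h0, h1, hNF⟩ := LoopFamily.exists_curried h
  obtain ⟨C, hC, c0, c1, cr⟩ := Path.exists_homotopy_trans_symm (t := t)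
  have hF' : ∀ s, Set.MapsTo (R.D s) (F ∪ {x | r x = x}) (F ∪ {x | r x = x}) := by
    rintro s x (hx | hx)
    · exact Or.inl (hF s hx)
    · exact Or.inr (by rwa [R.D_of_fixed hx])
  have hw := R.w.continuous
  have hc := R.continuous_cutoff
  -- The null homotopy `N` may move loops over the image of `r`. Since `r` is defined on all of X,
  -- this is corrected by multiplying with the inverse of `N` at `r x`. Over the image the product
  -- has the form p · p⁻¹, which `C` contracts, completely on the image and not at all where w =
  -- 1/2.
  have key : Continuous fun p : I × X =>
      if (R.w p.2 : ℝ) ≤ 1 / 2 then C (R.cutoff p.2) (N p.1 (r p.2))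
      else (N p.1 (R.D 1 p.2)).trans (N p.1 (r p.2)).symm := by
    have hNr : Continuous fun p : I × X => N p.1 (r p.2) :=
      hN.comp (by fun_prop : Continuous fun p : I × X => (p.1, r p.2))
    refine Continuous.if_le ?_ ?_ (by fun_prop) continuous_const ?_
    · exact hC.comp ((hc.comp continuous_snd).prodMk hNr)
    · exact (hN.comp (continuous_fst.prodMk (R.continuous_D_one.comp continuous_snd))).path_trans
        (Path.continuous_symm.comp hNr)
    · intro p hp
      rw [R.cutoff_of_half hp, c0, R.D_one_of_le hp.le]
  -- At time 0 the correcting factor is constant, because φ is constant on the image of `r`; this is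
  -- why the corrected homotopy starts at a product with 1.
  have e : φ.pullback ⟨R.D 1, R.continuous_D_one⟩ (hF' 1) * 1 ≈ φ :=
    Setoid.trans (LoopFamily.mul_one_equiv _) (R.comp_D_one_equiv hF' φ)
  refine Setoid.trans (Setoid.symm e) (LoopFamily.equiv_of_curried (fun s x =>
      if (R.w x : ℝ) ≤ 1 / 2 then C (R.cutoff x) (N s (r x))
      else (N s (R.D 1 x)).trans (N s (r x)).symm) key ?_ ?_ ?_)
  · intro x
    have hx : N 0 (r x) = Path.refl t := (h0 _).trans (φ.eq_refl _ (Or.inr R.retract_mem))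
    rw [LoopFamily.mul_apply, LoopFamily.one_apply, LoopFamily.pullback_apply, hx]
    split_ifs with hw
    · rw [cr]
      have : φ (R.D 1 x) = Path.refl t := by
        rw [R.D_one_of_le hw]
        exact φ.eq_refl _ (Or.inr R.retract_mem)
      exact (congrArg (Path.trans · (Path.refl t)) this).symm ▸ Path.refl_trans_refl.symm
    · rw [h0, Path.refl_symm]
      rfl
  · intro x
    simp only [h1, LoopFamily.one_apply, cr, Path.refl_symm, Path.refl_trans_refl, ite_self]
  · rintro s x (hx | hx)
    · simp only [hNF s _ (hr hx), hNF s _ (hF 1 hx), cr, Path.refl_symm, Path.refl_trans_refl,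
        ite_self]
    · rw [if_pos (R.w_of_fixed hx), R.cutoff_of_fixed hx, c1]

/-- For a group homomorphism a trivial kernel suffices, which is `equiv_one`. The set `F'` is a
variable so that the fat wedges below can be inserted without transporting loop classes along an
equality of sets. -/
theorem pullback_id_injective (hF : ∀ s, Set.MapsTo (R.D s) F F) (hr : Set.MapsTo r F F)
    {F' : Set X} (e : F' = F ∪ {x | r x = x}) (h : F ⊆ F') :
    Function.Injective (LoopClass.pullback (t := t) (ContinuousMap.id X)
      (ContinuousMap.mapsTo_id_of_subset h)) := by
  subst e
  rw [injective_iff_map_eq_one]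
  intro γ h
  obtain ⟨φ, rfl⟩ := LoopClass.mk_surjective γ
  exact LoopClass.mk_eq_mk.2 (R.equiv_one hF hr φ (LoopClass.mk_eq_mk.1 h))

theorem exists_pullback_id_eq (hF : ∀ s, Set.MapsTo (R.D s) F F) (hr : Set.MapsTo r F F)
    {F' : Set X} (e : F' = F ∪ {x | r x = x}) (h : F ⊆ F')
    (γ : LoopClass F t) (hγ : LoopClass.pullback r hr γ = 1) :
    ∃ δ, LoopClass.pullback (t := t) (ContinuousMap.id X)
      (ContinuousMap.mapsTo_id_of_subset h) δ = γ := by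
  subst e
  obtain ⟨φ, rfl⟩ := LoopClass.mk_surjective γ
  obtain ⟨ψ, hψ⟩ := R.exists_lift hF hr φ (LoopClass.mk_eq_mk.1 hγ)
  exact ⟨LoopClass.mk ψ, LoopClass.mk_eq_mk.2 hψ⟩

end NDRRetraction

end SplitCofibration

/-! ### Contracting a neighbourhood of the basepoint within the pair -/

section NondegenerateBasepoint

theorem continuous_if_le_projIcc {X Y : Type*} [TopologicalSpace X] [TopologicalSpace Y]
    (f g : I → X → Y) (hf : Continuous fun p : I × X => f p.1 p.2)
    (hg : Continuous fun p : I × X => g p.1 p.2) (h : ∀ x, f 1 x = g 0 x) :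
    Continuous fun p : I × X => if (p.1 : ℝ) ≤ 1 / 2
      then f (Set.projIcc 0 1 zero_le_one (2 * (p.1 : ℝ))) p.2
      else g (Set.projIcc 0 1 zero_le_one (2 * (p.1 : ℝ) - 1)) p.2 := by
  refine Continuous.if_le ?_ ?_ (by fun_prop) continuous_const ?_
  · exact hf.comp (by fun_prop : Continuous fun p : I × X =>
      (Set.projIcc (0 : ℝ) 1 zero_le_one (2 * (p.1 : ℝ)), p.2))
  · exact hg.comp (by fun_prop : Continuous fun p : I × X =>
      (Set.projIcc (0 : ℝ) 1 zero_le_one (2 * (p.1 : ℝ) - 1), p.2))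
  · intro p hp
    have h1 : Set.projIcc (0 : ℝ) 1 zero_le_one (2 * (p.1 : ℝ)) = 1 := by simp [hp]
    have h2 : Set.projIcc (0 : ℝ) 1 zero_le_one (2 * (p.1 : ℝ) - 1) = 0 := by simp [hp]
    rw [h1, h2, h]

/-- If `(X, A)` and `(A, a)` are NDR pairs, then a neighbourhood of `a` in `X` contracts to `a`
through maps that preserve `A`. -/
theorem IsNDRPair.exists_contraction {X : Type*} [TopologicalSpace X] {A : Set X} (a : A)
    (hA : IsNDRPair A) (ha : IsNDRPair ({a} : Set A)) :
    ∃ (w : C(X, I)) (D : I → X → X), Continuous (fun p : I × X => D p.1 p.2) ∧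
      (∀ x, D 0 x = x) ∧ (∀ s, D s a = a) ∧ (∀ s, ∀ x ∈ A, D s x ∈ A) ∧
      (∀ x, w x = 0 ↔ x = a) ∧ ∀ x, w x < 1 → D 1 x = a := by
  classical
  obtain ⟨u, h, hu, h0, hrel, h1⟩ := hA
  obtain ⟨v, k, hv, k0, krel, k1⟩ := ha
  have hone : ∀ x, (u x : ℝ) ≤ 3 / 4 → h (x, 1) ∈ A := fun x hx =>
    h1 x (Subtype.coe_lt_coe.1 (hx.trans_lt (by norm_num)))
  have hk : Continuous fun p : I × X => h (p.2, 1) := by fun_prop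
  -- The contraction `k` of A is applied after `h` has pushed x into A. The time factor 3 - 4u, cut
  -- off to [0,1], is 1 for u ≤ 1/2 and 0 for u ≥ 3/4, so `k` is damped out before `h (x, 1)` can
  -- leave A. The default value is never reached for u ≤ 3/4.
  let K : I → X → X := fun s x =>
    if hx : h (x, 1) ∈ A then
      k (⟨h (x, 1), hx⟩, s * Set.projIcc 0 1 zero_le_one (3 - 4 * (u x : ℝ))) else h (x, 1)
  have hK : ∀ s x (hx : h (x, 1) ∈ A), K s x =
      k (⟨h (x, 1), hx⟩, s * Set.projIcc 0 1 zero_le_one (3 - 4 * (u x : ℝ))) :=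
    fun s x hx => dif_pos hx
  let E : I → X → X := fun s x => if (u x : ℝ) ≤ 3 / 4 then K s x else h (x, 1)
  have hE : Continuous fun p : I × X => E p.1 p.2 := by
    refine continuous_if_le (by fun_prop) continuous_const ?_ hk.continuousOn ?_
    · rw [continuousOn_iff_continuous_domRestrict]
      have : Continuous fun p : {p : I × X | (u p.2 : ℝ) ≤ 3 / 4} =>
          (k (⟨h (p.1.2, 1), hone _ p.2⟩,
            p.1.1 * Set.projIcc 0 1 zero_le_one (3 - 4 * (u p.1.2 : ℝ))) : X) :=
        continuous_subtype_val.comp (k.continuous.comp ((Continuous.subtype_mk (by fun_prop) _).prodMk (by fun_prop)))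
      refine this.congr fun p => ?_
      exact (hK _ _ (hone _ p.2)).symm
    · intro p hp
      have e : Set.projIcc (0 : ℝ) 1 zero_le_one (3 - 4 * (u p.2 : ℝ)) = 0 :=
        Set.projIcc_of_le_left _ (by linarith)
      rw [hK _ _ (hone _ hp.le), e, mul_zero, k0]
  have hE0 : ∀ x, E 0 x = h (x, 1) := by
    intro x
    simp only [E, K]
    split_ifs <;> simp [k0]
  have hEA : ∀ s, ∀ x ∈ A, E s x ∈ A := by
    intro s x hx
    have hx1 : h (x, 1) ∈ A := by rwa [hrel x hx]
    simp only [E, hK s x hx1]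
    split_ifs
    · exact Subtype.property _
    · exact hx1
  have hEa : ∀ s, E s a = a := by
    intro s
    have e : h ((a : X), 1) = a := hrel a a.2 1
    have hx1 : h ((a : X), 1) ∈ A := by rw [e]; exact a.2
    simp only [E, hK s a hx1, krel a rfl, e, ite_self]
  have hE1 : ∀ x, (u x : ℝ) ≤ 1 / 2 → ∀ hx : h (x, 1) ∈ A, v ⟨h (x, 1), hx⟩ < 1 → E 1 x = a := by
    intro x hx hxA hxv
    have e : Set.projIcc (0 : ℝ) 1 zero_le_one (3 - 4 * (u x : ℝ)) = 1 :=
      Set.projIcc_of_right_le _ (by linarith)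
    simp only [E, hK 1 x hxA]
    rw [if_pos (by linarith), e, one_mul]
    exact congrArg Subtype.val (k1 _ hxv)
  let V : X → ℝ := fun x => if hx : h (x, 1) ∈ A then v ⟨h (x, 1), hx⟩ else 0
  have hV : ∀ x (hx : h (x, 1) ∈ A), V x = v ⟨h (x, 1), hx⟩ := fun x hx => dif_pos hx
  have hV0 : ∀ x, 0 ≤ V x := by
    intro x
    simp only [V]
    split_ifs
    · exact (v _).2.1
    · exact le_rfl
  -- At u = 1/2 the minimum is 1, whatever the value of `V`, so the pieces agree. W < 1 forces u ≤
  -- 1/2 and V < 1, where `k` acts undamped and ends at a; W = 0 forces both u and V to vanish.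
  let W : X → ℝ := fun x => if (u x : ℝ) ≤ 1 / 2 then min 1 (2 * (u x : ℝ) + V x) else 1
  have hW : Continuous W := by
    refine continuous_if_le (by fun_prop) continuous_const ?_ continuousOn_const ?_
    · refine ContinuousOn.inf continuousOn_const (ContinuousOn.add (by fun_prop) ?_)
      rw [continuousOn_iff_continuous_domRestrict]
      have : Continuous fun x : {x : X | (u x : ℝ) ≤ 1 / 2} =>
          (v ⟨h (x.1, 1), hone _ (x.2.out.trans (by norm_num))⟩ : ℝ) :=
        continuous_subtype_val.comp (v.continuous.comp (Continuous.subtype_mk (by fun_prop) _))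
      refine this.congr fun x => ?_
      exact (hV _ (hone _ (x.2.out.trans (by norm_num)))).symm
    · intro x hx
      rw [hx]
      exact min_eq_left (by linarith [hV0 x])
  have hWI : ∀ x, W x ∈ I := by
    intro x
    simp only [W]
    split_ifs
    · exact ⟨le_min zero_le_one (by linarith [hV0 x, (u x).2.1]), min_le_left _ _⟩
    · exact ⟨zero_le_one, le_rfl⟩
  have hWlt : ∀ x, W x < 1 → E 1 x = a := by
    intro x hx
    simp only [W] at hx
    split_ifs at hx with hxu
    · have hxA := hone x (hxu.trans (by norm_num))
      have hx' : V x < 1 := by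
        rcases min_lt_iff.1 hx with hx | hx
        · exact absurd hx (lt_irrefl _)
        · linarith [(u x).2.1]
      rw [hV x hxA] at hx'
      exact hE1 x hxu hxA hx'
    · exact absurd hx (lt_irrefl _)
  have hWzero : ∀ x, W x = 0 ↔ x = a := by
    intro x
    constructor
    · intro hx
      simp only [W] at hx
      split_ifs at hx with hxu
      · have hx2 : 2 * (u x : ℝ) + V x = 0 := by
          rcases min_choice 1 (2 * (u x : ℝ) + V x) with e | e
          · rw [e] at hx
            norm_num at hx
          · rwa [e] at hx
        have hux : u x = 0 := Subtype.ext (by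
          have := (u x).2.1
          have := hV0 x
          change (u x : ℝ) = 0
          linarith)
        have hxA : x ∈ A := (hu x).2 hux
        have e : h (x, 1) = x := hrel x hxA 1
        have hVx : V x = 0 := by
          have := (u x).2.1
          have := hV0 x
          linarith
        have hxA' : h (x, 1) ∈ A := by rwa [e]
        rw [hV x hxA'] at hVx
        have : (⟨h (x, 1), hxA'⟩ : A) = a := (hv _).2 (Subtype.ext hVx)
        exact e.symm.trans (congrArg Subtype.val this)
      · norm_num at hx
    · rintro rfl
      have e : h ((a : X), 1) = a := hrel a a.2 1
      have hx1 : h ((a : X), 1) ∈ A := by rw [e]; exact a.2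
      have e' : (⟨h ((a : X), 1), hx1⟩ : A) = a := Subtype.ext e
      have eu : u a = 0 := (hu a).1 a.2
      have ev : v a = 0 := (hv a).1 rfl
      simp [W, V, hx1, e', eu, ev]
  -- The deformation runs through `h` and then through `E`. Each preserves A: `h` fixes A pointwise,
  -- and on A the map `E` is given by `k`, which takes values in A, or is the identity.
  refine ⟨⟨fun x => ⟨W x, hWI x⟩, hW.subtype_mk _⟩, fun s x => if (s : ℝ) ≤ 1 / 2
    then h (x, Set.projIcc 0 1 zero_le_one (2 * (s : ℝ)))
    else E (Set.projIcc 0 1 zero_le_one (2 * (s : ℝ) - 1)) x,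
    continuous_if_le_projIcc (fun s x => h (x, s)) E (by fun_prop) hE fun x => (hE0 x).symm,
    ?_, ?_, ?_, ?_, ?_⟩
  · intro x
    simp [h0]
  · intro s
    dsimp only
    rw [hrel a a.2, hEa, ite_self]
  · intro s x hx
    dsimp only
    split_ifs
    · rwa [hrel x hx]
    · exact hEA _ x hx
  · intro x
    rw [← hWzero, Subtype.ext_iff]
    rfl
  · intro x hx
    have : Set.projIcc (0 : ℝ) 1 zero_le_one (2 * ((1 : I) : ℝ) - 1) = 1 := by norm_num
    dsimp only
    rw [if_neg (by norm_num), this]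
    exact hWlt x hx

end NondegenerateBasepoint

/-! ### Moving coordinates of the polyhedral product to the basepoint -/

namespace polyProd

variable {ι : Type} {K : PreAbstractSimplicialComplex ι} {P : ι → PtdPair.{u}}

/-- Membership in the polyhedral product, as a condition on families. -/
def Mem (K : PreAbstractSimplicialComplex ι) (x : ∀ i, (P i).toPtdTop) : Prop :=
  ∃ s : Finset ι, K.IsSimplex s ∧ ∀ i, i ∉ s → x i ∈ (P i).sub

/-- A point of the polyhedral product from its coordinates. -/
def mk (x : ∀ i, (P i).toPtdTop) (hx : Mem K x) : polyProd K P :=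
  ⟨x, by
    obtain ⟨s, hs, h⟩ := hx
    exact Set.mem_iUnion₂.2 ⟨s, hs, h⟩⟩

/-- The coordinates of a point of the polyhedral product. -/
def coord (x : polyProd K P) (i : ι) : (P i).toPtdTop := Subtype.val x i

theorem mem_coord (x : polyProd K P) : Mem K (coord x) := by
  obtain ⟨s, hs, h⟩ := Set.mem_iUnion₂.1 (Subtype.property x)
  exact ⟨s, hs, h⟩

theorem coord_pt (i : ι) : coord (polyProd K P).pt i = (P i).pt := rfl

theorem ext {x y : polyProd K P} (h : ∀ i, coord x i = coord y i) : x = y :=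
  Subtype.ext (funext h)

theorem continuous_coord (i : ι) : Continuous fun x : polyProd K P => coord x i :=
  (continuous_apply i).comp continuous_subtype_val

theorem continuous_mk {Y : Type*} [TopologicalSpace Y] {f : Y → ∀ i, (P i).toPtdTop}
    (hf : ∀ i, Continuous fun y => f y i) (hm : ∀ y, Mem K (f y)) :
    Continuous fun y => mk (f y) (hm y) :=
  Continuous.subtype_mk (continuous_pi hf) _

theorem Mem.of_imp {x y : ∀ i, (P i).toPtdTop} (hx : Mem K x)
    (h : ∀ i, x i ∈ (P i).sub → y i ∈ (P i).sub) : Mem K y := by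
  obtain ⟨s, hs, hm⟩ := hx
  exact ⟨s, hs, fun i hi => h i (hm i hi)⟩

/-- The points with some coordinate in `S` at the basepoint, together with the basepoint. -/
def fat (K : PreAbstractSimplicialComplex ι) (P : ι → PtdPair.{u}) (S : Finset ι) :
    Set (polyProd K P) :=
  {x | x = (polyProd K P).pt ∨ ∃ i ∈ S, coord x i = (P i).pt}

theorem pt_subset_fat (S : Finset ι) : {(polyProd K P).pt} ⊆ fat K P S := fun _ hx => Or.inl hx

theorem fat_empty : fat K P ∅ = {(polyProd K P).pt} := by
  ext x
  simp [fat]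

theorem mapsTo_fat {f : polyProd K P → polyProd K P} (S : Finset ι)
    (hf : f (polyProd K P).pt = (polyProd K P).pt)
    (h : ∀ x, ∀ i ∈ S, coord x i = (P i).pt → coord (f x) i = (P i).pt) :
    Set.MapsTo f (fat K P S) (fat K P S) := by
  rintro x (rfl | ⟨i, hi, hx⟩)
  · exact Or.inl hf
  · exact Or.inr ⟨i, hi, h x i hi hx⟩

section

variable [DecidableEq ι]

/-- The map that moves the coordinates in `S` to the basepoint. -/
def kill (S : Finset ι) : C(polyProd K P, polyProd K P) where
  toFun x := mk (fun i => if i ∈ S then (P i).pt else coord x i) ((mem_coord x).of_imp (by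
    intro i hi
    split_ifs
    exacts [(P i).pt_mem, hi]))
  continuous_toFun := continuous_mk (by
    intro i
    split_ifs
    exacts [continuous_const, continuous_coord i]) _

theorem coord_kill (S : Finset ι) (x : polyProd K P) (i : ι) :
    coord (kill S x) i = if i ∈ S then (P i).pt else coord x i := rfl

theorem kill_pt (S : Finset ι) : kill S (polyProd K P).pt = (polyProd K P).pt :=
  ext fun i => by rw [coord_kill, coord_pt, ite_self]

theorem kill_kill (S S' : Finset ι) (x : polyProd K P) : kill S (kill S' x) = kill (S ∪ S') x :=
  ext fun i => by
    simp only [coord_kill, Finset.mem_union]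
    split_ifs <;> tauto

theorem kill_singleton_eq_iff (i : ι) (x : polyProd K P) :
    kill {i} x = x ↔ coord x i = (P i).pt := by
  constructor
  · intro h
    rw [← h, coord_kill, if_pos (Finset.mem_singleton_self i)]
  · intro h
    refine ext fun j => ?_
    rw [coord_kill]
    split_ifs with hj
    · obtain rfl := Finset.mem_singleton.1 hj
      exact h.symm
    · rfl

theorem fat_insert (i : ι) (S : Finset ι) :
    fat K P (insert i S) = fat K P S ∪ {x | kill {i} x = x} := by
  ext x
  simp only [fat, Finset.mem_insert, exists_eq_or_imp, Set.mem_ofPred_eq, Set.mem_union,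
    kill_singleton_eq_iff]
  rw [or_assoc, or_comm (a := coord x i = _)]

theorem fat_subset_insert (i : ι) (S : Finset ι) : fat K P S ⊆ fat K P (insert i S) := by
  rw [fat_insert]
  exact Set.subset_union_left

theorem mapsTo_kill_fat (S' S : Finset ι) :
    Set.MapsTo (kill S') (fat K P S) (fat K P S) :=
  mapsTo_fat S (kill_pt S') fun x i _ hx => by rw [coord_kill, hx, ite_self]

theorem mapsTo_kill (S : Finset ι) :
    Set.MapsTo (kill S) {(polyProd K P).pt} {(polyProd K P).pt} := by
  rintro _ rfl
  exact kill_pt S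

/-- The homomorphism induced by moving one coordinate to the basepoint. -/
noncomputable def killHom (K : PreAbstractSimplicialComplex ι) (P : ι → PtdPair.{u})
    {T : Type*} [TopologicalSpace T] (t : T) (i : ι) :
    LoopClass {(polyProd K P).pt} t →* LoopClass {(polyProd K P).pt} t :=
  LoopClass.pullback (kill {i}) (mapsTo_kill {i})

/-- Only coordinate i is deformed. The result stays in the polyhedral product because the
contraction preserves the subspace A_i, and in every `fat K P S` because it fixes the basepoint. The
latter is needed for all `S` at once in the induction of `pullback_fat`. -/
theorem exists_ndrRetraction (hP : ∀ i, (P i).IsNDR) (i : ι) :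
    ∃ R : NDRRetraction (kill {i} : C(polyProd K P, polyProd K P)),
      ∀ S s, Set.MapsTo (R.D s) (fat K P S) (fat K P S) := by
  obtain ⟨w, D, hD, D0, Dpt, Dsub, hw, hw1⟩ :=
    IsNDRPair.exists_contraction (X := (P i).toPtdTop) (A := (P i).sub) ⟨(P i).pt, (P i).pt_mem⟩
      (hP i).pair (hP i).pt
  have hmem : ∀ s (x : polyProd K P),
      Mem K (Function.update (coord x) i (D s (coord x i))) := by
    intro s x
    refine (mem_coord x).of_imp fun j hj => ?_
    rcases eq_or_ne j i with rfl | h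
    · rw [Function.update_self]
      exact Dsub s _ hj
    · rwa [Function.update_of_ne h]
  let E : I → polyProd K P → polyProd K P := fun s x => mk _ (hmem s x)
  have hE : ∀ s x, coord (E s x) i = D s (coord x i) := fun s x => Function.update_self ..
  have hE' : ∀ s x j, j ≠ i → coord (E s x) j = coord x j :=
    fun s x j hj => Function.update_of_ne hj ..
  have hkill : ∀ x : polyProd K P, coord (kill {i} x) i = (P i).pt := fun x => by
    rw [coord_kill, if_pos (Finset.mem_singleton_self i)]
  have hkill' : ∀ (x : polyProd K P) j, j ≠ i → coord (kill {i} x) j = coord x j :=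
    fun x j hj => by rw [coord_kill, if_neg (by simpa using hj)]
  have ext' : ∀ x y : polyProd K P, coord x i = coord y i →
      (∀ j, j ≠ i → coord x j = coord y j) → x = y := fun x y h h' => ext fun j => by
    rcases eq_or_ne j i with rfl | hj
    exacts [h, h' j hj]
  refine ⟨{
    D := E
    continuous_D := ?_
    D_zero := fun x => ext' _ _ (by rw [hE, D0]) fun j hj => hE' _ _ j hj
    retract_D := fun s x => ext' _ _ (by rw [hkill, hkill]) fun j hj => by
      rw [hkill' _ j hj, hkill' _ j hj, hE' _ _ j hj]
    D_retract := fun s x => ext' _ _ (by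
      rw [hE, hkill]
      exact Dpt s) fun j hj => hE' _ _ j hj
    retract_retract := fun x => by rw [kill_kill, Finset.union_idempotent]
    w := ⟨fun x => w (coord x i), w.continuous.comp (continuous_coord i)⟩
    D_one := fun x hx => ext' _ _ (by
      rw [hE, hkill]
      exact hw1 _ hx) fun j hj => by rw [hE' _ _ j hj, hkill' _ j hj]
    w_eq_zero := fun x => (hw _).trans (kill_singleton_eq_iff i x).symm }, ?_⟩
  · refine continuous_mk (fun j => ?_) _
    rcases eq_or_ne j i with rfl | h
    · simp only [Function.update_self]
      exact hD.comp (continuous_fst.prodMk ((continuous_coord j).comp continuous_snd))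
    · simp only [Function.update_of_ne h]
      exact (continuous_coord j).comp continuous_snd
  · intro S s
    refine mapsTo_fat S (ext' _ _ ?_ fun j hj => hE' _ _ j hj) fun x j _ hx => ?_
    · exact (hE _ _).trans (Dpt s)
    · rcases eq_or_ne j i with rfl | hj
      · refine (hE _ _).trans ?_
        rw [hx]
        exact Dpt s
      · exact (hE' _ _ j hj).trans hx

variable {T : Type*} [TopologicalSpace T] {t : T}

/-- Adding i to `S` enlarges the fat set by the image of the retraction `kill {i}`, so each step of
the induction is an instance of the split cofibration results. Both claims are proved together,
since existence for the larger set uses injectivity for the smaller one. -/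
theorem pullback_fat (hP : ∀ i, (P i).IsNDR) (S : Finset ι) :
    Function.Injective (LoopClass.pullback (t := t) (ContinuousMap.id (polyProd K P))
      (ContinuousMap.mapsTo_id_of_subset (pt_subset_fat S))) ∧
    ∀ γ : LoopClass {(polyProd K P).pt} t, (∀ i ∈ S, killHom K P t i γ = 1) →
      ∃ δ, LoopClass.pullback (ContinuousMap.id (polyProd K P))
        (ContinuousMap.mapsTo_id_of_subset (pt_subset_fat S)) δ = γ := by
  induction S using Finset.induction_on with
  | empty =>
    have h : fat K P ∅ ⊆ {(polyProd K P).pt} := fat_empty.subset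
    have key : ∀ γ : LoopClass {(polyProd K P).pt} t, LoopClass.pullback (ContinuousMap.id _)
        (ContinuousMap.mapsTo_id_of_subset (pt_subset_fat ∅)) (LoopClass.pullback
          (ContinuousMap.id _) (ContinuousMap.mapsTo_id_of_subset h) γ) = γ := fun γ => by
      rw [LoopClass.pullback_pullback _ _ _ _ (ContinuousMap.id _) (Set.mapsTo_id _)
        fun _ => rfl]
      exact LoopClass.pullback_of_eq_id _ _ (fun _ => rfl) γ
    have key' : ∀ γ : LoopClass (fat K P ∅) t, LoopClass.pullback (ContinuousMap.id _)
        (ContinuousMap.mapsTo_id_of_subset h) (LoopClass.pullback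
          (ContinuousMap.id _) (ContinuousMap.mapsTo_id_of_subset (pt_subset_fat ∅)) γ) = γ :=
      fun γ => by
        rw [LoopClass.pullback_pullback _ _ _ _ (ContinuousMap.id _) (Set.mapsTo_id _)
          fun _ => rfl]
        exact LoopClass.pullback_of_eq_id _ _ (fun _ => rfl) γ
    exact ⟨Function.LeftInverse.injective key', fun γ _ => ⟨_, key γ⟩⟩
  | insert i S _ ih =>
    obtain ⟨R, hR⟩ := exists_ndrRetraction (K := K) hP i
    have comp : ∀ δ : LoopClass (fat K P (insert i S)) t,
        LoopClass.pullback (ContinuousMap.id _)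
          (ContinuousMap.mapsTo_id_of_subset (pt_subset_fat S))
          (LoopClass.pullback (ContinuousMap.id _)
            (ContinuousMap.mapsTo_id_of_subset (fat_subset_insert i S)) δ) =
        LoopClass.pullback (ContinuousMap.id _)
          (ContinuousMap.mapsTo_id_of_subset (pt_subset_fat (insert i S))) δ := fun δ =>
      LoopClass.pullback_pullback _ _ _ _ _ _ (fun _ => rfl) δ
    refine ⟨?_, fun γ hγ => ?_⟩
    · have h := ih.1.comp (R.pullback_id_injective (t := t) (hR S) (mapsTo_kill_fat _ S)
        (fat_insert i S) (fat_subset_insert i S))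
      intro δ δ' e
      refine h ?_
      simpa only [Function.comp_apply, comp] using e
    · obtain ⟨δ, hδ⟩ := ih.2 γ fun j hj => hγ j (Finset.mem_insert_of_mem hj)
      obtain ⟨δ', hδ'⟩ := R.exists_pullback_id_eq (hR S) (mapsTo_kill_fat _ S) (fat_insert i S)
        (fat_subset_insert i S) δ (by
          -- The restriction of δ to the image of `kill {i}` must be trivial relative to `fat K P
          -- S`. By injectivity this can be checked relative to the basepoint, where it is the
          -- hypothesis on γ.
          apply ih.1
          rw [map_one, ← hγ i (Finset.mem_insert_self i S), killHom, ← hδ,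
            LoopClass.pullback_pullback _ _ _ _ (kill {i}) (fun x hx => mapsTo_kill_fat _ S
              (pt_subset_fat S hx)) fun _ => rfl,
            LoopClass.pullback_pullback _ _ _ _ (kill {i}) (fun x hx => mapsTo_kill_fat _ S
              (pt_subset_fat S hx)) fun _ => rfl])
      exact ⟨δ', by rw [← comp, hδ', hδ]⟩

theorem pullback_kill_eq_self (S : Finset ι) (γ : LoopClass {(polyProd K P).pt} t)
    (h : ∀ i ∈ S, killHom K P t i γ = γ) : LoopClass.pullback (kill S) (mapsTo_kill S) γ = γ := by
  induction S using Finset.induction_on with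
  | empty =>
    exact LoopClass.pullback_of_eq_id _ _ (fun x => ext fun i => by simp [coord_kill]) γ
  | insert i S _ ih =>
    conv_rhs => rw [← ih fun j hj => h j (Finset.mem_insert_of_mem hj),
      ← h i (Finset.mem_insert_self i S)]
    rw [killHom, LoopClass.pullback_pullback _ _ _ _ (kill (insert i S)) (mapsTo_kill _)]
    intro x
    rw [kill_kill, Finset.insert_eq]

theorem eq_one_of_killHom_eq_self [Fintype ι] (γ : LoopClass {(polyProd K P).pt} t)
    (h : ∀ i, killHom K P t i γ = γ) : γ = 1 := by
  rw [← pullback_kill_eq_self Finset.univ γ fun i _ => h i]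
  refine LoopClass.pullback_eq_one _ _ (fun x => Set.mem_singleton_iff.2 (ext fun i => ?_)) γ
  rw [coord_kill, if_pos (Finset.mem_univ i), coord_pt]

theorem mem_restrict {x : ∀ i, (P i).toPtdTop} (hx : Mem K x) (J : Finset ι) :
    Mem (P := fun i : J => P i) (K.restrict J) fun i => x i := by
  obtain ⟨s, hs, h⟩ := hx
  refine ⟨s.subtype (· ∈ J), ?_, fun i hi => h i (by simpa using hi)⟩
  rcases Finset.eq_empty_or_nonempty (s.subtype (· ∈ J)) with e | e
  · exact Or.inl e
  · refine Or.inr ?_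
    change (s.subtype (· ∈ J)).map (Function.Embedding.subtype _) ∈ K
    have hsub : (s.subtype (· ∈ J)).map (Function.Embedding.subtype _) ⊆ s := by
      rw [Finset.subtype_map]
      exact Finset.filter_subset _ _
    rcases hs with rfl | hs
    · obtain ⟨a, ha⟩ := e
      simp at ha
    · exact (K.isRelLowerSet_faces hs).2 hsub e.map

/-- The projection to the polyhedral product over a full subcomplex. -/
def proj (K : PreAbstractSimplicialComplex ι) (P : ι → PtdPair.{u}) (J : Finset ι) :
    C(polyProd K P, polyProd (K.restrict J) (fun i : J => P i)) where
  toFun x := mk (fun i => coord x i) (mem_restrict (mem_coord x) J)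
  continuous_toFun := continuous_mk (fun i => continuous_coord i.1)
    fun x => mem_restrict (mem_coord x) J

theorem coord_proj (J : Finset ι) (x : polyProd K P) (i : J) :
    coord (proj K P J x) i = coord x i := rfl

theorem mem_extend {J : Finset ι} {x : ∀ i : J, (P i).toPtdTop}
    (hx : Mem (P := fun i : J => P i) (K.restrict J) x) :
    Mem K fun i => if h : i ∈ J then x ⟨i, h⟩ else (P i).pt := by
  obtain ⟨s, hs, h⟩ := hx
  refine ⟨s.map (Function.Embedding.subtype _), ?_, fun i hi => ?_⟩
  · rcases hs with rfl | hs
    · exact Or.inl rfl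
    · exact Or.inr hs
  · dsimp only
    split_ifs with hJ
    · exact h ⟨i, hJ⟩ fun hs => hi (Finset.mem_map.2 ⟨_, hs, rfl⟩)
    · exact (P i).pt_mem

/-- The inclusion of the polyhedral product over a full subcomplex. -/
def incl (K : PreAbstractSimplicialComplex ι) (P : ι → PtdPair.{u}) (J : Finset ι) :
    C(polyProd (K.restrict J) (fun i : J => P i), polyProd K P) where
  toFun x := mk (fun i => if h : i ∈ J then coord x ⟨i, h⟩ else (P i).pt)
    (mem_extend (mem_coord x))
  continuous_toFun := continuous_mk (by
    intro i
    split_ifs with h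
    exacts [continuous_coord (⟨i, h⟩ : J), continuous_const]) fun x => mem_extend (mem_coord x)

theorem coord_incl (J : Finset ι) (x : polyProd (K.restrict J) (fun i : J => P i)) (i : ι) :
    coord (incl K P J x) i = if h : i ∈ J then coord x ⟨i, h⟩ else (P i).pt := rfl

theorem proj_incl (J : Finset ι) (x : polyProd (K.restrict J) (fun i : J => P i)) :
    proj K P J (incl K P J x) = x :=
  ext fun i => by rw [coord_proj, coord_incl, dif_pos i.2]

theorem proj_pt (J : Finset ι) : proj K P J (polyProd K P).pt = (polyProd _ _).pt := rfl

theorem incl_pt (J : Finset ι) : incl K P J (polyProd _ _).pt = (polyProd K P).pt :=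
  ext fun i => by
    rw [coord_incl]
    split_ifs <;> rfl

theorem incl_proj [Fintype ι] (J : Finset ι) (x : polyProd K P) :
    incl K P J (proj K P J x) = kill Jᶜ x :=
  ext fun i => by
    rw [coord_incl, coord_kill]
    simp only [Finset.mem_compl]
    split_ifs <;> rfl

theorem proj_kill_of_notMem {J : Finset ι} {i : ι} (hi : i ∉ J) (x : polyProd K P) :
    proj K P J (kill {i} x) = proj K P J x :=
  ext fun j => by
    rw [coord_proj, coord_proj, coord_kill, if_neg]
    rw [Finset.mem_singleton]
    rintro rfl
    exact hi j.2

theorem mapsTo_proj_fat (J : Finset ι) : Set.MapsTo (proj K P J) {(polyProd K P).pt}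
    (fat (K.restrict J) (fun i : J => P i) Finset.univ) := by
  rintro _ rfl
  exact Or.inl rfl

theorem mapsTo_proj (J : Finset ι) : Set.MapsTo (proj K P J) {(polyProd K P).pt}
    {(polyProd (K.restrict J) (fun i : J => P i)).pt} := by
  rintro _ rfl
  rfl

theorem mapsTo_incl (J : Finset ι) : Set.MapsTo (incl K P J)
    {(polyProd (K.restrict J) (fun i : J => P i)).pt} {(polyProd K P).pt} := by
  rintro _ rfl
  exact incl_pt J

theorem pullback_proj_fat_eq (J : Finset ι)
    (δ : LoopClass (fat (K.restrict J) (fun i : J => P i) Finset.univ) t) :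
    LoopClass.pullback (proj K P J) (mapsTo_proj_fat J) δ =
      LoopClass.pullback (proj K P J) (mapsTo_proj J) (LoopClass.pullback (ContinuousMap.id _)
        (ContinuousMap.mapsTo_id_of_subset (pt_subset_fat Finset.univ)) δ) :=
  (LoopClass.pullback_pullback _ _ _ _ _ _ (fun _ => rfl) δ).symm

/-- The projection has the section `incl`, so pullback along it is injective; passing from the fat
wedge to the basepoint is injective by `pullback_fat`. -/
theorem pullback_proj_fat_injective (hP : ∀ i, (P i).IsNDR) (J : Finset ι) :
    Function.Injective (LoopClass.pullback (t := t) (proj K P J) (mapsTo_proj_fat J)) := by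
  have h : Function.LeftInverse (LoopClass.pullback (t := t) (incl K P J) (mapsTo_incl J))
      (LoopClass.pullback (proj K P J) (mapsTo_proj J)) := fun γ => by
    rw [LoopClass.pullback_pullback _ _ _ _ (ContinuousMap.id _) (Set.mapsTo_id _) (proj_incl J)]
    exact LoopClass.pullback_of_eq_id _ _ (fun _ => rfl) γ
  intro δ δ' e
  rw [pullback_proj_fat_eq, pullback_proj_fat_eq] at e
  exact (pullback_fat (fun i : J => hP i) Finset.univ).1 (h.injective e)

theorem killHom_pullback_proj_of_notMem {J : Finset ι} {i : ι} (hi : i ∉ J)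
    (δ : LoopClass (fat (K.restrict J) (fun i : J => P i) Finset.univ) t) :
    killHom K P t i (LoopClass.pullback (proj K P J) (mapsTo_proj_fat J) δ) =
      LoopClass.pullback (proj K P J) (mapsTo_proj_fat J) δ :=
  LoopClass.pullback_pullback _ _ _ _ _ _ (proj_kill_of_notMem hi) δ

theorem killHom_pullback_proj_of_mem {J : Finset ι} {i : ι} (hi : i ∈ J)
    (δ : LoopClass (fat (K.restrict J) (fun i : J => P i) Finset.univ) t) :
    killHom K P t i (LoopClass.pullback (proj K P J) (mapsTo_proj_fat J) δ) = 1 := by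
  have h : ∀ x, proj K P J (kill {i} x) ∈
      fat (K.restrict J) (fun i : J => P i) Finset.univ := fun x =>
    Or.inr ⟨⟨i, hi⟩, Finset.mem_univ _, by
      rw [coord_proj, coord_kill, if_pos (Finset.mem_singleton_self i)]⟩
  rw [killHom, LoopClass.pullback_pullback _ _ _ _ ((proj K P J).comp (kill {i}))
    (fun x _ => h x) fun _ => rfl]
  exact LoopClass.pullback_eq_one _ _ h δ

/-- Since γ is fixed by the endomorphisms outside `J`, it is its own pullback along `kill Jᶜ`, which
is `incl` after `proj`; so it comes from its restriction to the full subcomplex. That restriction is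
killed by the endomorphisms in `J`, and `pullback_fat` makes it constant over the fat wedge. -/
theorem exists_pullback_proj_eq [Fintype ι] (hP : ∀ i, (P i).IsNDR) (J : Finset ι)
    (γ : LoopClass {(polyProd K P).pt} t) (h1 : ∀ i ∈ J, killHom K P t i γ = 1)
    (h2 : ∀ i, i ∉ J → killHom K P t i γ = γ) :
    ∃ δ, LoopClass.pullback (proj K P J) (mapsTo_proj_fat J) δ = γ := by
  have e : LoopClass.pullback (proj K P J) (mapsTo_proj J)
      (LoopClass.pullback (incl K P J) (mapsTo_incl J) γ) = γ := by
    rw [LoopClass.pullback_pullback _ _ _ _ (kill Jᶜ) (mapsTo_kill _) (incl_proj J)]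
    exact pullback_kill_eq_self _ γ fun i hi => h2 i (Finset.mem_compl.1 hi)
  obtain ⟨δ, hδ⟩ := (pullback_fat (fun i : J => hP i) Finset.univ).2
    (LoopClass.pullback (incl K P J) (mapsTo_incl J) γ) (by
      intro i _
      have comp := LoopClass.pullback_pullback (incl K P J) (mapsTo_incl J) (kill {i.1})
        (mapsTo_kill _) ((kill {i.1}).comp (incl K P J))
        ((mapsTo_kill _).comp (mapsTo_incl J)) (fun _ => rfl) γ
      have h : LoopClass.pullback (kill {i.1}) (mapsTo_kill _) γ = 1 := h1 i.1 i.2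
      rw [h, map_one] at comp
      rw [comp, killHom]
      refine LoopClass.pullback_pullback _ _ _ _ _ _ (fun x => ext fun j => ?_) γ
      change coord (incl K P J (kill {i} x)) j = coord (kill {i.1} (incl K P J x)) j
      rw [coord_incl, coord_kill, coord_incl]
      simp only [coord_kill, Finset.mem_singleton, Subtype.ext_iff]
      split_ifs <;> rfl)
  exact ⟨δ, by rw [pullback_proj_fat_eq, hδ, e]⟩

end

end polyProd

/-! ### Homogeneous factorizations under commuting idempotents of a group -/

section CommutingIdempotents

variable {ι G : Type*} [DecidableEq ι] [Group G]

/-- The subsets of the set of entries of a list; those that contain the head come last. -/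
def List.subsetList : List ι → List (Finset ι)
  | [] => [∅]
  | a :: l => l.subsetList ++ l.subsetList.map (insert a)

theorem List.subset_of_mem_subsetList {l : List ι} {J : Finset ι} (h : J ∈ l.subsetList) :
    J ⊆ l.toFinset := by
  induction l generalizing J with
  | nil =>
    obtain rfl : J = ∅ := by simpa [List.subsetList] using h
    exact Finset.empty_subset _
  | cons a l ih =>
    rw [List.toFinset_cons]
    rcases List.mem_append.1 h with h | h
    · exact (ih h).trans (Finset.subset_insert _ _)
    · obtain ⟨J', h', rfl⟩ := List.mem_map.1 h
      exact Finset.insert_subset_insert _ (ih h')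

/-- For a family of endomorphisms, the elements that are killed by the endomorphisms with
index in `J` and fixed by the other ones. -/
def IsHomogeneous (r : ι → G →* G) (l : List ι) (J : Finset ι) (g : G) : Prop :=
  ∀ i ∈ l, (i ∈ J → r i g = 1) ∧ (i ∉ J → r i g = g)

/-- For commuting idempotent endomorphisms of a group, each element is a product of homogeneous
elements. -/
theorem exists_isHomogeneous_prod (r : ι → G →* G) (comm : ∀ i j g, r i (r j g) = r j (r i g))
    (idem : ∀ i g, r i (r i g) = r i g) (l : List ι) (hl : l.Nodup) (N : Subgroup G)
    (hN : ∀ i ∈ l, ∀ g ∈ N, r i g ∈ N) (g : G) (hg : g ∈ N) :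
    ∃ c : Finset ι → G, (∀ J, c J ∈ N) ∧ (∀ J ⊆ l.toFinset, IsHomogeneous r l J (c J)) ∧
      (l.subsetList.map c).prod = g := by
  induction l generalizing N g with
  | nil =>
    refine ⟨fun _ => g, fun _ => hg, fun J _ i hi => ?_, by simp [List.subsetList]⟩
    simp at hi
  | cons a l ih =>
    obtain ⟨ha, hl⟩ := List.nodup_cons.1 hl
    have hN' : ∀ i ∈ l, ∀ g ∈ N, r i g ∈ N := fun i hi => hN i (List.mem_cons_of_mem _ hi)
    have hra : r a g ∈ N := hN a List.mem_cons_self g hg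
    -- The splitting is g = r_a(g) · (r_a(g)⁻¹ g), with the first factor fixed and the second killed
    -- by r_a. The subgroup `N` records such conditions through the induction; commutativity of the
    -- endomorphisms makes the two smaller subgroups stable under the remaining ones.
    obtain ⟨c₁, h₁, k₁, p₁⟩ := ih hl (N ⊓ (r a).eqLocus (MonoidHom.id G))
      (fun i hi g hg => ⟨hN' i hi g hg.1, (comm a i g).trans (congrArg (r i) hg.2)⟩)
      (r a g) ⟨hra, idem a g⟩
    obtain ⟨c₂, h₂, k₂, p₂⟩ := ih hl (N ⊓ (r a).ker)
      (fun i hi g hg => ⟨hN' i hi g hg.1, (comm a i g).trans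
        ((congrArg (r i) hg.2).trans (map_one _))⟩)
      ((r a g)⁻¹ * g) ⟨N.mul_mem (N.inv_mem hra) hg, by
        change r a ((r a g)⁻¹ * g) = 1
        rw [map_mul, map_inv, idem, inv_mul_cancel]⟩
    refine ⟨fun J => if a ∈ J then c₂ (J.erase a) else c₁ J, fun J => ?_, fun J hJ i hi => ?_, ?_⟩
    · dsimp only
      split_ifs
      exacts [(h₂ _).1, (h₁ _).1]
    · rw [List.toFinset_cons] at hJ
      dsimp only
      split_ifs with haJ
      · rcases List.mem_cons.1 hi with rfl | hil
        · exact ⟨fun _ => (h₂ _).2, fun h => absurd haJ h⟩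
        · have hia : i ≠ a := by
            rintro rfl
            exact ha hil
          have hk := k₂ (J.erase a) (Finset.subset_insert_iff.1 hJ) i hil
          rwa [Finset.mem_erase, and_iff_right hia] at hk
      · rcases List.mem_cons.1 hi with rfl | hil
        · exact ⟨fun h => absurd h haJ, fun _ => (h₁ _).2⟩
        · exact k₁ J ((Finset.subset_insert_iff_of_notMem haJ).1 hJ) i hil
    · have hmem : ∀ J ∈ l.subsetList, a ∉ J := fun J hJ h =>
        ha (List.mem_toFinset.1 (List.subset_of_mem_subsetList hJ h))
      have e₂ : l.subsetList.map ((fun J => if a ∈ J then c₂ (J.erase a) else c₁ J) ∘ insert a) =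
          l.subsetList.map c₂ := List.map_congr_left fun J hJ => by
        rw [Function.comp_apply, if_pos (Finset.mem_insert_self a J),
          Finset.erase_insert (hmem J hJ)]
      rw [List.subsetList, List.map_append, List.prod_append, List.map_map, e₂, p₂,
        List.map_congr_left (g := c₁) fun J hJ => if_neg (hmem J hJ), p₁, mul_inv_cancel_left]

/-- For endomorphisms of a group, a factorization into homogeneous elements is unique. -/
theorem isHomogeneous_prod_unique (r : ι → G →* G) (l : List ι) (hl : l.Nodup)
    (c c' : Finset ι → G) (hc : ∀ J ⊆ l.toFinset, IsHomogeneous r l J (c J))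
    (hc' : ∀ J ⊆ l.toFinset, IsHomogeneous r l J (c' J))
    (h : (l.subsetList.map c).prod = (l.subsetList.map c').prod) (J : Finset ι)
    (hJ : J ⊆ l.toFinset) : c J = c' J := by
  induction l generalizing c c' J with
  | nil =>
    obtain rfl : J = ∅ := Finset.subset_empty.1 hJ
    simpa [List.subsetList] using h
  | cons a l ih =>
    obtain ⟨ha, hl⟩ := List.nodup_cons.1 hl
    have hmem : ∀ J ⊆ l.toFinset, a ∉ J := fun J hJ h => ha (List.mem_toFinset.1 (hJ h))
    have hins : ∀ J ⊆ l.toFinset, insert a J ⊆ (a :: l).toFinset := fun J hJ => by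
      rw [List.toFinset_cons]
      exact Finset.insert_subset_insert _ hJ
    have hsub : ∀ J ⊆ l.toFinset, J ⊆ (a :: l).toFinset := fun J hJ =>
      (Finset.subset_insert a J).trans (hins J hJ)
    have fixed : ∀ d : Finset ι → G, (∀ J ⊆ (a :: l).toFinset, IsHomogeneous r (a :: l) J (d J)) →
        r a ((l.subsetList.map d).prod) = (l.subsetList.map d).prod := fun d hd => by
      rw [map_list_prod, List.map_map]
      refine congrArg List.prod (List.map_congr_left fun J hJ => ?_)
      have hJ' := List.subset_of_mem_subsetList hJ
      exact (hd J (hsub J hJ') a List.mem_cons_self).2 (hmem J hJ')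
    have killed : ∀ d : Finset ι → G, (∀ J ⊆ (a :: l).toFinset, IsHomogeneous r (a :: l) J (d J)) →
        r a ((l.subsetList.map (d ∘ insert a)).prod) = 1 := fun d hd => by
      rw [map_list_prod, List.map_map]
      refine List.prod_eq_one fun x hx => ?_
      obtain ⟨J, hJ, rfl⟩ := List.mem_map.1 hx
      exact (hd _ (hins J (List.subset_of_mem_subsetList hJ)) a List.mem_cons_self).1
        (Finset.mem_insert_self a J)
    have homog : ∀ d : Finset ι → G, (∀ J ⊆ (a :: l).toFinset, IsHomogeneous r (a :: l) J (d J)) →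
        ∀ J ⊆ l.toFinset, IsHomogeneous r l J (d (insert a J)) := fun d hd J hJ i hi => by
      have hia : i ≠ a := by
        rintro rfl
        exact ha hi
      have hk := hd _ (hins J hJ) i (List.mem_cons_of_mem _ hi)
      rwa [Finset.mem_insert, or_iff_right hia] at hk
    simp only [List.subsetList, List.map_append, List.prod_append, List.map_map] at h
    -- Applying r_a erases the factors whose index contains a and fixes the others. As the erased
    -- factors come last, the remaining ones cancel from the left without commutativity of the
    -- group.
    have h₁ : (l.subsetList.map c).prod = (l.subsetList.map c').prod := by
      have := congrArg (r a) h
      rwa [map_mul, map_mul, fixed c hc, fixed c' hc', killed c hc, killed c' hc', mul_one,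
        mul_one] at this
    rw [h₁, mul_right_inj] at h
    by_cases haJ : a ∈ J
    · have hJ' : J.erase a ⊆ l.toFinset := by
        rwa [List.toFinset_cons, Finset.subset_insert_iff] at hJ
      have := ih hl (c ∘ insert a) (c' ∘ insert a) (homog c hc) (homog c' hc') h _ hJ'
      rwa [Function.comp_apply, Function.comp_apply, Finset.insert_erase haJ] at this
    · refine ih hl c c' (fun J hJ i hi => hc J (hsub J hJ) i (List.mem_cons_of_mem _ hi))
        (fun J hJ i hi => hc' J (hsub J hJ) i (List.mem_cons_of_mem _ hi)) h₁ J ?_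
      rwa [List.toFinset_cons, Finset.subset_insert_iff_of_notMem haJ] at hJ

end CommutingIdempotents

/-! ### Loop classes of quotients and wedges -/

section Quotients

variable {X Y T : Type*} [TopologicalSpace X] [TopologicalSpace Y] [TopologicalSpace T] {t : T}

/-- Collapsing a subspace over which loop families are constant does not change their homotopy
classes. -/
theorem LoopClass.pullback_bijective_of_isQuotientMap {q : C(X, Y)}
    (hq : Topology.IsQuotientMap q) {F : Set X} {F' : Set Y} (hF : Set.MapsTo q F F')
    (hF' : ∀ x, q x ∈ F' → x ∈ F) (h : ∀ x x', q x = q x' → x = x' ∨ x ∈ F ∧ x' ∈ F) :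
    Function.Bijective (LoopClass.pullback (t := t) q hF) := by
  have factor : ∀ {Z : Type _} (f : X → Z) (z : Z), (∀ x ∈ F, f x = z) →
      ∀ x x', q x = q x' → f x = f x' := fun f z hf x x' hx => by
    rcases h x x' hx with rfl | ⟨hx, hx'⟩
    · rfl
    · rw [hf x hx, hf x' hx']
  constructor
  · intro γ γ' e
    obtain ⟨φ, rfl⟩ := LoopClass.mk_surjective γ
    obtain ⟨ψ, rfl⟩ := LoopClass.mk_surjective γ'
    obtain ⟨H, hH, h0, h1, hHF⟩ := LoopFamily.exists_curried (LoopClass.mk_eq_mk.1 e)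
    have key : ∀ s x, H s (Function.surjInv hq.surjective (q x)) = H s x := fun s x =>
      factor (H s) _ (hHF s) _ _ (Function.surjInv_eq hq.surjective (q x))
    refine LoopClass.mk_eq_mk.2 (LoopFamily.equiv_of_curried
      (fun s y => H s (Function.surjInv hq.surjective y)) ?_ ?_ ?_ ?_)
    -- The interval is locally compact, so its product with a quotient map is again a quotient map
    -- and the homotopy descends.
    · refine hq.continuous_lift_prod_right ?_
      simpa only [key] using hH
    · intro y
      obtain ⟨x, rfl⟩ := hq.surjective y
      rw [key, h0]
      rfl
    · intro y
      obtain ⟨x, rfl⟩ := hq.surjective y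
      rw [key, h1]
      rfl
    · intro s y hy
      obtain ⟨x, rfl⟩ := hq.surjective y
      rw [key, hHF s x (hF' x hy)]
  · intro γ
    obtain ⟨φ, rfl⟩ := LoopClass.mk_surjective γ
    let ψ : C(Y, Path t t) := hq.lift φ.toCont (factor φ _ φ.eq_refl)
    have hψ : ∀ x, ψ (q x) = φ x := fun x =>
      DFunLike.congr_fun (hq.lift_comp φ.toCont (factor φ _ φ.eq_refl)) x
    refine ⟨LoopClass.mk ⟨ψ, fun y hy => ?_⟩, congrArg LoopClass.mk (LoopFamily.ext hψ)⟩
    obtain ⟨x, rfl⟩ := hq.surjective y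
    rw [hψ, φ.eq_refl x (hF' x hy)]

end Quotients

namespace PtdTop

theorem Map.mapsTo_pt {X Y : PtdTop.{u}} (f : Map X Y) : Set.MapsTo f {X.pt} {Y.pt} := by
  rintro _ rfl
  exact f.map_pt

section Wedge

variable {ι : Type} (Y : ι → PtdTop.{u})

/-- The inclusion of a summand of a wedge. -/
def wedgeIn (i : ι) : Map (Y i) (wedge Y) where
  toCont := ⟨fun y => collapseMk _ _ (Sum.inr ⟨i, y⟩ : PUnit.{u + 1} ⊕ (Σ i, Y i)),
    (collapseMk _ _).toCont.continuous.comp (continuous_inr.comp continuous_sigmaMk)⟩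
  map_pt := Quotient.sound (Or.inr ⟨Or.inr ⟨i, rfl⟩, Or.inl rfl⟩)

variable {T : Type*} [TopologicalSpace T] {t : T}

/-- Currying turns the homotopies into maps to the path space `C(I, Z)`, which can be glued over a
disjoint union. -/
theorem disjUnion_glue {Z : Type*} [TopologicalSpace Z] (f : ∀ i, C(I × Y i, Z)) (z : Z) :
    Continuous fun p : I × (PUnit.{u + 1} ⊕ (Σ i, Y i)) =>
      Sum.elim (fun _ => z) (fun y => f y.1 (p.1, y.2)) p.2 := by
  let g : PUnit.{u + 1} ⊕ (Σ i, Y i) → C(I, Z) :=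
    Sum.elim (fun _ => ContinuousMap.const I z)
      (fun y => ((f y.1).comp ContinuousMap.prodSwap).curry y.2)
  have hg : Continuous g := by
    refine continuous_sum_dom.2 ⟨continuous_const, continuous_sigma fun i => ?_⟩
    exact ((f i).comp ContinuousMap.prodSwap).curry.continuous
  have := (ContinuousMap.continuous_uncurry_of_continuous ⟨g, hg⟩).comp
    (continuous_snd.prodMk continuous_fst :
      Continuous fun p : I × (PUnit.{u + 1} ⊕ (Σ i, Y i)) => (p.2, p.1))
  refine this.congr ?_
  rintro ⟨s, y | y⟩ <;> rfl

/-- A loop family over a wedge is the same as a collection of families over the summands. -/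
theorem loopClass_wedge :
    Function.Bijective fun (γ : LoopClass {(wedge Y).pt} t) (i : ι) =>
      LoopClass.pullback (wedgeIn Y i).toCont (wedgeIn Y i).mapsTo_pt γ := by
  let F : Set (disjUnion Y) :=
    {x | x = (disjUnion Y).pt ∨ x ∈ Set.range fun i => Sum.inr ⟨i, (Y i).pt⟩}
  let q : C(disjUnion Y, wedge Y) := (collapseMk _ _).toCont
  have hq : Topology.IsQuotientMap q := isQuotientMap_quot_mk
  have hF : Set.MapsTo q F {(wedge Y).pt} := fun x hx =>
    Quotient.sound (Or.inr ⟨hx, Or.inl rfl⟩)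
  have rel : ∀ x x', q x = q x' → x = x' ∨ x ∈ F ∧ x' ∈ F := fun x x' h => Quotient.exact h
  have hF' : ∀ x, q x ∈ ({(wedge Y).pt} : Set _) → x ∈ F := fun x hx => by
    rcases rel x (disjUnion Y).pt hx with rfl | h
    exacts [Or.inl rfl, h.1]
  have bij := LoopClass.pullback_bijective_of_isQuotientMap (t := t) hq hF hF' rel
  let j : ∀ i, C(Y i, disjUnion Y) := fun i =>
    ⟨fun y => (Sum.inr ⟨i, y⟩ : PUnit.{u + 1} ⊕ (Σ i, Y i)),
      continuous_inr.comp continuous_sigmaMk⟩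
  have hj : ∀ i, Set.MapsTo (j i) {(Y i).pt} F := by
    rintro i _ rfl
    exact Or.inr ⟨i, rfl⟩
  have comp : ∀ γ i, LoopClass.pullback (wedgeIn Y i).toCont (wedgeIn Y i).mapsTo_pt γ =
      LoopClass.pullback (j i) (hj i) (LoopClass.pullback (t := t) q hF γ) := fun γ i =>
    (LoopClass.pullback_pullback _ _ _ _ _ _ (fun _ => rfl) γ).symm
  simp only [comp]
  refine Function.Bijective.comp (g := fun (γ : LoopClass F t) i =>
    LoopClass.pullback (j i) (hj i) γ) ⟨fun γ γ' e => ?_, fun γ => ?_⟩ bij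
  · obtain ⟨φ, rfl⟩ := LoopClass.mk_surjective γ
    obtain ⟨ψ, rfl⟩ := LoopClass.mk_surjective γ'
    choose H hH h0 h1 hHF using fun i =>
      LoopFamily.exists_curried (LoopClass.mk_eq_mk.1 (congrFun e i))
    refine LoopClass.mk_eq_mk.2 (LoopFamily.equiv_of_curried (fun s (x : disjUnion Y) =>
      Sum.elim (fun _ => Path.refl t) (fun y : Σ i, Y i => H y.1 s y.2) x)
      (disjUnion_glue Y (fun i => ⟨fun p => H i p.1 p.2, hH i⟩) (Path.refl t)) ?_ ?_ ?_)
    · rintro (x | ⟨i, y⟩)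
      · exact (φ.eq_refl _ (Or.inl rfl)).symm
      · exact h0 i y
    · rintro (x | ⟨i, y⟩)
      · exact (ψ.eq_refl _ (Or.inl rfl)).symm
      · exact h1 i y
    · rintro s _ (rfl | ⟨i, rfl⟩)
      · rfl
      · exact hHF i s _ rfl
  · choose φ hφ using fun i => LoopClass.mk_surjective (γ i)
    have hc : Continuous fun x : disjUnion Y =>
        Sum.elim (fun _ => Path.refl t) (fun y : Σ i, Y i => φ y.1 y.2) x :=
      continuous_sum_dom.2 ⟨continuous_const, continuous_sigma fun i => (φ i).continuous⟩
    refine ⟨LoopClass.mk (LoopFamily.of _ hc ?_), funext fun i => ?_⟩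
    · rintro _ (rfl | ⟨i, rfl⟩)
      · rfl
      · exact (φ i).eq_refl _ rfl
    · rw [← hφ i]
      rfl

end Wedge

/-- The saturation of a closed set is the set itself or its union with the collapsed set. -/
theorem isClosedMap_collapseMk (X : PtdTop.{u}) (S : Set X)
    (hS : IsClosed {x | x = X.pt ∨ x ∈ S}) : IsClosedMap (collapseMk X S) := by
  intro C hC
  have hq : Topology.IsQuotientMap (collapseMk X S) := isQuotientMap_quot_mk
  rw [← hq.isClosed_preimage]
  have rel : ∀ x x', collapseMk X S x = collapseMk X S x' ↔
      x = x' ∨ (x = X.pt ∨ x ∈ S) ∧ (x' = X.pt ∨ x' ∈ S) := fun x x' => Quotient.eq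
  by_cases h : ∃ x ∈ C, x = X.pt ∨ x ∈ S
  · obtain ⟨c, hc, hcS⟩ := h
    convert hC.union hS using 1
    ext x
    constructor
    · rintro ⟨y, hy, e⟩
      rcases (rel y x).1 e with rfl | h
      exacts [Or.inl hy, Or.inr h.2]
    · rintro (hx | hx)
      · exact ⟨x, hx, rfl⟩
      · exact ⟨c, hc, (rel _ _).2 (Or.inr ⟨hcS, hx⟩)⟩
  · convert hC using 1
    ext x
    constructor
    · rintro ⟨y, hy, e⟩
      rcases (rel y x).1 e with rfl | h'
      exacts [hy, absurd ⟨y, hy, h'.1⟩ h]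
    · exact fun hx => ⟨x, hx, rfl⟩

end PtdTop

/-! ### The polyhedral smash product as a quotient of the polyhedral product -/

namespace polyProd

variable {ι : Type} {K : PreAbstractSimplicialComplex ι} {P : ι → PtdPair.{u}}

/-- The projection from the polyhedral product to the polyhedral smash product. -/
def toSmash (K : PreAbstractSimplicialComplex ι) (P : ι → PtdPair.{u}) :
    PtdTop.Map (polyProd K P) (polySmash K P) :=
  PtdTop.subspaceMap (PtdTop.smashMk fun i => (P i).toPtdTop) (by
    intro x hx
    obtain ⟨s, hs, hx⟩ := Set.mem_iUnion₂.1 hx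
    exact Set.mem_iUnion₂.2 ⟨s, hs, x, hx, rfl⟩)

theorem isClosed_pt (hP : ∀ i, (P i).IsNDR) (i : ι) : IsClosed {(P i).pt} := by
  obtain ⟨w, D, -, -, -, -, hw, -⟩ :=
    IsNDRPair.exists_contraction (X := (P i).toPtdTop) (A := (P i).sub) ⟨(P i).pt, (P i).pt_mem⟩
      (hP i).pair (hP i).pt
  have : ({(P i).pt} : Set (P i).toPtdTop) = w ⁻¹' {0} := by
    ext x
    exact (hw x).symm
  rw [this]
  exact isClosed_singleton.preimage w.continuous

theorem isClosed_sub (hP : ∀ i, (P i).IsNDR) (i : ι) : IsClosed (P i).sub := by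
  obtain ⟨v, -, hv, -⟩ := (hP i).pair
  have : (P i).sub = v ⁻¹' {0} := by
    ext x
    exact hv x
  rw [this]
  exact isClosed_singleton.preimage v.continuous

variable [Fintype ι]

theorem isClosed_polyProd (hP : ∀ i, (P i).IsNDR) :
    IsClosed (⋃ (s : Finset ι) (_ : K.IsSimplex s), pairPower P s) := by
  refine isClosed_iUnion_of_finite fun s => isClosed_iUnion_of_finite fun _ => ?_
  have : pairPower P s = ⋂ (i) (_ : i ∉ s), (fun x : ∀ i, (P i).toPtdTop => x i) ⁻¹' (P i).sub := by
    ext x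
    refine Iff.trans ?_ Set.mem_iInter₂.symm
    rfl
  rw [this]
  exact isClosed_iInter fun i => isClosed_iInter fun _ =>
    (isClosed_sub hP i).preimage (continuous_apply i)

/-- The polyhedral smash product has the subspace topology of the full smash product, while loop
families descend along quotient maps. Closedness reconciles the two: basepoints and the A_i are
closed by the NDR hypotheses, so the polyhedral product and the fat wedge are closed. -/
theorem isClosedMap_toSmash (hP : ∀ i, (P i).IsNDR) : IsClosedMap (toSmash K P) := by
  have hclosed : IsClosedMap (PtdTop.smashMk fun i => (P i).toPtdTop) := by
    refine PtdTop.isClosedMap_collapseMk _ _ ?_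
    have h1 : IsClosed {(PtdTop.prod fun i => (P i).toPtdTop).pt} := by
      have : ({(PtdTop.prod fun i => (P i).toPtdTop).pt} : Set (∀ i, (P i).toPtdTop)) =
          ⋂ i, (fun x : ∀ i, (P i).toPtdTop => x i) ⁻¹' {(P i).pt} := by
        ext x
        refine Iff.trans ?_ Set.mem_iInter.symm
        exact funext_iff
      have h := isClosed_iInter fun i => (isClosed_pt hP i).preimage (continuous_apply i)
      rwa [← this] at h
    have h2 : IsClosed (PtdTop.fatWedge fun i => (P i).toPtdTop) := by
      have : PtdTop.fatWedge (fun i => (P i).toPtdTop) =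
          ⋃ i, (fun x : ∀ i, (P i).toPtdTop => x i) ⁻¹' {(P i).pt} := by
        ext x
        refine Iff.trans ?_ Set.mem_iUnion.symm
        rfl
      rw [this]
      exact isClosed_iUnion_of_finite fun i => (isClosed_pt hP i).preimage (continuous_apply i)
    exact h1.union h2
  intro C hC
  have hC' := hclosed _ ((isClosed_polyProd hP).isClosedMap_subtype_val C hC)
  have e : toSmash K P '' C =
      (Subtype.val : polySmash K P → PtdTop.smash fun i => (P i).toPtdTop) ⁻¹'
        (PtdTop.smashMk (fun i => (P i).toPtdTop) '' (Subtype.val '' C)) := by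
    ext y
    constructor
    · rintro ⟨x, hx, rfl⟩
      exact ⟨x.1, ⟨x, hx, rfl⟩, rfl⟩
    · rintro ⟨_, ⟨x, hx, rfl⟩, e⟩
      exact ⟨x, hx, Subtype.ext e⟩
  rw [e]
  exact hC'.preimage continuous_subtype_val

theorem isQuotientMap_toSmash (hP : ∀ i, (P i).IsNDR) :
    Topology.IsQuotientMap (toSmash K P) := by
  refine (isClosedMap_toSmash hP).isQuotientMap (toSmash K P).toCont.continuous ?_
  rintro ⟨y, hy⟩
  obtain ⟨s, hs, x, hx, rfl⟩ := Set.mem_iUnion₂.1 hy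
  exact ⟨⟨x, Set.mem_iUnion₂.2 ⟨s, hs, hx⟩⟩, rfl⟩

theorem mem_fat_univ_iff (x : polyProd K P) : x ∈ fat K P Finset.univ ↔
    Subtype.val x = (PtdTop.prod fun i => (P i).toPtdTop).pt ∨
      Subtype.val x ∈ PtdTop.fatWedge fun i => (P i).toPtdTop := by
  refine or_congr ?_ ?_
  · exact Subtype.ext_iff
  · exact exists_congr fun i => and_iff_right (Finset.mem_univ i)

theorem toSmash_eq_iff (x x' : polyProd K P) : toSmash K P x = toSmash K P x' ↔
    x = x' ∨ x ∈ fat K P Finset.univ ∧ x' ∈ fat K P Finset.univ :=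
  Subtype.ext_iff.trans <| Quotient.eq.trans <| or_congr Subtype.ext_iff.symm <|
    and_congr (mem_fat_univ_iff x).symm (mem_fat_univ_iff x').symm

theorem mapsTo_toSmash :
    Set.MapsTo (toSmash K P) (fat K P Finset.univ) {(polySmash K P).pt} := fun x hx =>
  ((toSmash_eq_iff x (polyProd K P).pt).2 (Or.inr ⟨hx, Or.inl rfl⟩)).trans (toSmash K P).map_pt

theorem loopClass_polySmash (hP : ∀ i, (P i).IsNDR) {T : Type*} [TopologicalSpace T] {t : T} :
    Function.Bijective (LoopClass.pullback (t := t) (toSmash K P).toCont mapsTo_toSmash) := by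
  refine LoopClass.pullback_bijective_of_isQuotientMap (isQuotientMap_toSmash hP) _
    (fun x hx => ?_) fun x x' => (toSmash_eq_iff x x').1
  rcases (toSmash_eq_iff x (polyProd K P).pt).1 (hx.trans (toSmash K P).map_pt.symm) with rfl | h
  exacts [Or.inl rfl, h.1]

end polyProd

/-! ### The suspension–loop adjunction and sums of suspended maps -/

namespace LoopFamily

variable {X Y T T' : Type*} [TopologicalSpace X] [TopologicalSpace Y] [TopologicalSpace T]
  [TopologicalSpace T'] {F : Set X} {F' : Set Y} {t : T} {t' : T'}

/-- The concatenation of a list of loop families. -/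
noncomputable def listProd (l : List (LoopFamily F t)) : LoopFamily F t := l.foldr (· * ·) 1

theorem mk_listProd (l : List (LoopFamily F t)) :
    LoopClass.mk (listProd l) = (l.map LoopClass.mk).prod := by
  induction l with
  | nil => rfl
  | cons φ l ih => rw [List.map_cons, List.prod_cons, ← ih]; rfl

/-- The equality holds at each time, not only up to homotopy, since both sides are concatenated with
the same parametrization. This is the source of strict naturality. -/
theorem apply_listProd {A : Type*} (l : List A) (a : A → LoopFamily F t)
    (b : A → LoopFamily F' t') (g : T → T') (hg : g t = t') (x : X) (y : Y)
    (h : ∀ j s, g (a j x s) = b j y s) (s : I) :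
    g (listProd (l.map a) x s) = listProd (l.map b) y s := by
  induction l generalizing s with
  | nil => exact hg
  | cons j l ih =>
    change g (((a j x).trans (listProd (l.map a) x)) s) =
      ((b j y).trans (listProd (l.map b) y)) s
    rw [Path.trans_apply, Path.trans_apply]
    split_ifs
    exacts [h j _, ih _]

end LoopFamily

namespace PtdTop

variable {X Y Z T : PtdTop.{u}}

theorem Map.ext' {f g : Map X Y} (h : ∀ x, f x = g x) : f = g :=
  Map.ext (ContinuousMap.ext h)

theorem Map.Homotopic.comp_left {f g : Map X Y} (h : Map.Homotopic f g) (k : Map Y Z) :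
    Map.Homotopic (k.comp f) (k.comp g) :=
  ContinuousMap.HomotopicRel.comp_continuousMap h k.toCont

/-- A map that induces bijections on homotopy classes of maps to all pointed spaces is
a homotopy equivalence. -/
theorem Map.isHomotopyEquiv_of_bijective (f : Map X Y)
    (hs : ∀ (T : PtdTop.{u}) (φ : Map X T), ∃ g : Map Y T, Map.Homotopic (g.comp f) φ)
    (hi : ∀ (T : PtdTop.{u}) (g g' : Map Y T), Map.Homotopic (g.comp f) (g'.comp f) →
      Map.Homotopic g g') : f.IsHomotopyEquiv := by
  -- Surjectivity for T = X gives a left inverse g. Then f g f is homotopic to f, so injectivity for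
  -- T = Y makes g a right inverse.
  obtain ⟨g, hg⟩ := hs X (Map.id X)
  exact ⟨g, hg, hi Y (f.comp g) (Map.id Y) (hg.comp_left f)⟩

/-- The point of the suspension with given coordinates. -/
def suspMk (x : X) (s : I) : X.susp := collapseMk X.cylinder _ ((x, s) : X × I)

theorem isQuotientMap_suspMk :
    Topology.IsQuotientMap fun p : X × I => suspMk p.1 p.2 := isQuotientMap_quot_mk

theorem continuous_suspMk : Continuous fun p : X × I => suspMk p.1 p.2 :=
  isQuotientMap_suspMk.continuous

theorem suspMk_eq_pt {x : X} {s : I} (h : x = X.pt ∨ s = 0 ∨ s = 1) : suspMk x s = X.susp.pt :=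
  Quotient.sound (Or.inr ⟨Or.inr h, Or.inl rfl⟩)

theorem suspMk_eq_suspMk {p p' : X × I} (h : suspMk p.1 p.2 = suspMk p'.1 p'.2) :
    p = p' ∨ (p.1 = X.pt ∨ p.2 = 0 ∨ p.2 = 1) ∧ (p'.1 = X.pt ∨ p'.2 = 0 ∨ p'.2 = 1) := by
  have key : ∀ q : X × I, q = (X.pt, 0) ∨ (q.1 = X.pt ∨ q.2 = 0 ∨ q.2 = 1) →
      q.1 = X.pt ∨ q.2 = 0 ∨ q.2 = 1 := by
    rintro q (rfl | h)
    exacts [Or.inl rfl, h]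
  exact (Quotient.exact h).imp id fun h => ⟨key p h.1, key p' h.2⟩

theorem susp_ext {f g : Map X.susp T} (h : ∀ x s, f (suspMk x s) = g (suspMk x s)) : f = g :=
  Map.ext' fun y => by
    obtain ⟨p, rfl⟩ := isQuotientMap_suspMk.surjective y
    exact h p.1 p.2

/-- The loop family adjoint to a map from a suspension. -/
def adjoint (f : Map X.susp T) : LoopFamily {X.pt} T.pt :=
  LoopFamily.of
    (fun x => {
      toFun := fun s => f (suspMk x s)
      continuous_toFun := f.toCont.continuous.comp
        (continuous_suspMk.comp (continuous_const.prodMk continuous_id))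
      source' := (congrArg f (suspMk_eq_pt (Or.inr (Or.inl rfl)))).trans f.map_pt
      target' := (congrArg f (suspMk_eq_pt (Or.inr (Or.inr rfl)))).trans f.map_pt })
    (Path.continuous_uncurry_iff.1 (f.toCont.continuous.comp continuous_suspMk))
    (by
      rintro _ rfl
      ext s
      exact (congrArg f (suspMk_eq_pt (Or.inl rfl))).trans f.map_pt)

theorem loopFamily_apply_eq_pt (φ : LoopFamily {X.pt} T.pt) {x : X} {s : I}
    (h : x = X.pt ∨ s = 0 ∨ s = 1) : φ x s = T.pt := by
  rcases h with rfl | rfl | rfl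
  · rw [φ.eq_refl _ rfl]
    rfl
  · exact (φ x).source
  · exact (φ x).target

theorem loopFamily_apply_eq_of_suspMk_eq (φ : LoopFamily {X.pt} T.pt) (p p' : X × I)
    (h : suspMk p.1 p.2 = suspMk p'.1 p'.2) : φ p.1 p.2 = φ p'.1 p'.2 := by
  rcases suspMk_eq_suspMk h with rfl | ⟨h, h'⟩
  · rfl
  · rw [loopFamily_apply_eq_pt φ h, loopFamily_apply_eq_pt φ h']

/-- The map from a suspension adjoint to a loop family. -/
noncomputable def ofLoopFamily (φ : LoopFamily {X.pt} T.pt) : Map X.susp T where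
  toCont := isQuotientMap_suspMk.lift (f := ⟨_, continuous_suspMk⟩)
    ⟨fun p : X × I => φ p.1 p.2, Path.continuous_uncurry_iff.2 φ.continuous⟩
    (loopFamily_apply_eq_of_suspMk_eq φ)
  map_pt := (DFunLike.congr_fun (isQuotientMap_suspMk.lift_comp (f := ⟨_, continuous_suspMk⟩)
    ⟨fun p : X × I => φ p.1 p.2, Path.continuous_uncurry_iff.2 φ.continuous⟩
    (loopFamily_apply_eq_of_suspMk_eq φ)) (X.pt, 0)).trans (φ X.pt).source

theorem ofLoopFamily_suspMk (φ : LoopFamily {X.pt} T.pt) (x : X) (s : I) :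
    ofLoopFamily φ (suspMk x s) = φ x s :=
  DFunLike.congr_fun (isQuotientMap_suspMk.lift_comp (f := ⟨_, continuous_suspMk⟩)
    ⟨fun p : X × I => φ p.1 p.2, Path.continuous_uncurry_iff.2 φ.continuous⟩
    (loopFamily_apply_eq_of_suspMk_eq φ)) (x, s)

theorem adjoint_ofLoopFamily (φ : LoopFamily {X.pt} T.pt) : adjoint (ofLoopFamily φ) = φ :=
  LoopFamily.ext fun x => by
    ext s
    exact ofLoopFamily_suspMk φ x s

theorem homotopic_of_adjoint_equiv {f g : Map X.susp T} (h : adjoint f ≈ adjoint g) :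
    Map.Homotopic f g := by
  obtain ⟨H, hH, h0, h1, hF⟩ := LoopFamily.exists_curried h
  have hq := isQuotientMap_suspMk (X := X)
  let H' : ∀ s : I, LoopFamily {X.pt} T.pt := fun s =>
    LoopFamily.of (H s) (hH.comp (continuous_const.prodMk continuous_id)) (hF s)
  have key : ∀ s x r, ofLoopFamily (H' s) (suspMk x r) = H s x r := fun s x r =>
    ofLoopFamily_suspMk (H' s) x r
  refine ContinuousMap.HomotopicRel.of_curried (fun s y => ofLoopFamily (H' s) y) ?_ ?_ ?_ ?_
  · refine hq.continuous_lift_prod_right ?_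
    simp only [key]
    have : Continuous fun q : (I × X) × I => H q.1.1 q.1.2 q.2 :=
      Path.continuous_uncurry_iff.2 hH
    exact this.comp (by fun_prop : Continuous fun p : I × (X × I) => ((p.1, p.2.1), p.2.2))
  · intro y
    obtain ⟨⟨x, r⟩, rfl⟩ := hq.surjective y
    exact (key 0 x r).trans (DFunLike.congr_fun (h0 x) r)
  · intro y
    obtain ⟨⟨x, r⟩, rfl⟩ := hq.surjective y
    exact (key 1 x r).trans (DFunLike.congr_fun (h1 x) r)
  · rintro s _ rfl
    exact (ofLoopFamily (H' s)).map_pt.trans f.map_pt.symm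

theorem adjoint_equiv_of_homotopic {f g : Map X.susp T} (h : Map.Homotopic f g) :
    adjoint f ≈ adjoint g := by
  obtain ⟨H, hH, h0, h1, hF⟩ := ContinuousMap.HomotopicRel.exists_curried h
  let H' : I → Map X.susp T := fun s =>
    ⟨⟨H s, hH.comp (continuous_const.prodMk continuous_id)⟩, (hF s _ rfl).trans f.map_pt⟩
  refine LoopFamily.equiv_of_curried (fun s => adjoint (H' s)) ?_ ?_ ?_ ?_
  · refine Path.continuous_uncurry_iff.1 ?_
    change Continuous fun q : (I × X) × I => H q.1.1 (suspMk q.1.2 q.2)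
    exact hH.comp ((by fun_prop : Continuous fun q : (I × X) × I => q.1.1).prodMk
      (continuous_suspMk.comp (by fun_prop : Continuous fun q : (I × X) × I => (q.1.2, q.2))))
  · intro x
    ext r
    exact h0 _
  · intro x
    ext r
    exact h1 _
  · exact fun s x hx => (adjoint (H' s)).eq_refl x hx

/-- The sum of the suspensions of a list of maps, in the co-H-structure of a suspension. -/
noncomputable def suspSum {A : Type*} (l : List A) (f : A → Map X Y) : Map X.susp Y.susp :=
  ofLoopFamily (LoopFamily.listProd (l.map fun j =>
    (adjoint (Map.id Y.susp)).pullback (f j).toCont (f j).mapsTo_pt))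

theorem adjoint_comp_suspSum {A : Type*} (l : List A) (f : A → Map X Y) (g : Map Y.susp T) :
    adjoint (g.comp (suspSum l f)) =
      LoopFamily.listProd (l.map fun j => (adjoint g).pullback (f j).toCont (f j).mapsTo_pt) :=
  LoopFamily.ext fun x => by
    ext s
    refine (congrArg g (ofLoopFamily_suspMk _ x s)).trans ?_
    exact LoopFamily.apply_listProd l _ _ g g.map_pt x x (fun _ _ => rfl) s

/-- This translates precomposition with a sum of suspensions into a product in the group of loop
classes, where the algebra of homogeneous factorizations applies. -/
theorem mk_adjoint_comp_suspSum {A : Type*} (l : List A) (f : A → Map X Y) (g : Map Y.susp T) :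
    LoopClass.mk (adjoint (g.comp (suspSum l f))) = (l.map fun j =>
      LoopClass.pullback (f j).toCont (f j).mapsTo_pt (LoopClass.mk (adjoint g))).prod := by
  rw [adjoint_comp_suspSum, LoopFamily.mk_listProd, List.map_map]
  rfl

theorem suspSum_natural {A : Type*} (l : List A) {X' Y' : PtdTop.{u}} (f : A → Map X Y)
    (f' : A → Map X' Y') (p : Map X X') (q : Map Y Y') (h : ∀ j x, f' j (p x) = q (f j x)) :
    (suspSum l f').comp (suspMap p) = (suspMap q).comp (suspSum l f) :=
  susp_ext fun x s => by
    refine (ofLoopFamily_suspMk _ (p x) s).trans (Eq.symm ?_)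
    refine (congrArg (suspMap q) (ofLoopFamily_suspMk _ x s)).trans ?_
    refine LoopFamily.apply_listProd l _ _ (suspMap q) (suspMap q).map_pt x (p x) ?_ s
    intro j r
    exact congrArg (suspMk · r) (h j x).symm

/-- The constant map. -/
def Map.const (X Y : PtdTop.{u}) : Map X Y := ⟨ContinuousMap.const X Y.pt, rfl⟩

end PtdTop

/-! ### The splitting map and its bijectivity on loop classes -/

section Splitting

open PtdTop polyProd

variable {m : ℕ} (K : PreAbstractSimplicialComplex (Fin m)) (P : Fin m → PtdPair.{u})

/-- The inclusion of a polyhedral smash product into the wedge. -/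
def wedgePolySmashIn (J : {J : Finset (Fin m) // J.Nonempty}) :
    PtdTop.Map (polySmash (K.restrict J.1) (fun i : J.1 => P i)) (wedgePolySmash K P) :=
  wedgeIn (fun J : {J : Finset (Fin m) // J.Nonempty} =>
    polySmash (K.restrict J.1) (fun i : J.1 => P i)) J

/-- The composite of the projection of the polyhedral product to the polyhedral smash product
over a full subcomplex and the inclusion into the wedge; for the empty set, the constant map. -/
noncomputable def polyProd.toWedge (J : Finset (Fin m)) :
    PtdTop.Map (polyProd K P) (wedgePolySmash K P) :=
  if h : J.Nonempty then
    (wedgePolySmashIn K P ⟨J, h⟩).comp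
      ((toSmash (K.restrict J) (fun i : J => P i)).comp ⟨proj K P J, proj_pt J⟩)
  else PtdTop.Map.const _ _

theorem polyProd.toWedge_of_nonempty {J : Finset (Fin m)} (h : J.Nonempty) : toWedge K P J =
    (wedgePolySmashIn K P ⟨J, h⟩).comp
      ((toSmash (K.restrict J) (fun i : J => P i)).comp ⟨proj K P J, proj_pt J⟩) :=
  dif_pos h

theorem polyProd.toWedge_empty : toWedge K P ∅ = PtdTop.Map.const _ _ :=
  dif_neg Finset.not_nonempty_empty

theorem polyProd.toWedge_natural {P Q : Fin m → PtdPair.{u}} (f : ∀ i, PtdPair.Map (P i) (Q i))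
    (J : Finset (Fin m)) (x : polyProd K P) :
    toWedge K Q J (polyProdMap K f x) = wedgePolySmashMap K f (toWedge K P J x) := by
  rcases J.eq_empty_or_nonempty with rfl | h
  · rw [toWedge_empty, toWedge_empty]
    exact (wedgePolySmashMap K f).map_pt.symm
  · rw [toWedge_of_nonempty K Q h, toWedge_of_nonempty K P h]
    rfl

variable {T : Type*} [TopologicalSpace T] {t : T}

theorem loopClass_wedgePolySmash : Function.Bijective
    fun (γ : LoopClass {(wedgePolySmash K P).pt} t) (J : {J : Finset (Fin m) // J.Nonempty}) =>
      LoopClass.pullback (wedgePolySmashIn K P J).toCont (wedgePolySmashIn K P J).mapsTo_pt γ :=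
  loopClass_wedge _

theorem polyProd.pullback_toWedge {J : Finset (Fin m)} (h : J.Nonempty)
    (γ : LoopClass {(wedgePolySmash K P).pt} t) :
    LoopClass.pullback (toWedge K P J).toCont (toWedge K P J).mapsTo_pt γ =
      LoopClass.pullback (proj K P J) (mapsTo_proj_fat J)
        (LoopClass.pullback (toSmash (K.restrict J) (fun i : J => P i)).toCont mapsTo_toSmash
          (LoopClass.pullback (wedgePolySmashIn K P ⟨J, h⟩).toCont
            (wedgePolySmashIn K P ⟨J, h⟩).mapsTo_pt γ)) := by
  obtain ⟨φ, rfl⟩ := LoopClass.mk_surjective γ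
  simp only [LoopClass.pullback_mk]
  congr 1
  ext1 x
  simp only [LoopFamily.pullback_apply, toWedge_of_nonempty K P h]
  rfl

theorem polyProd.pullback_toWedge_empty (γ : LoopClass {(wedgePolySmash K P).pt} t) :
    LoopClass.pullback (toWedge K P ∅).toCont (toWedge K P ∅).mapsTo_pt γ = 1 := by
  refine LoopClass.pullback_eq_one _ _ (fun x => ?_) γ
  rw [toWedge_empty]
  rfl

theorem polyProd.isHomogeneous_pullback_toWedge (J : Finset (Fin m))
    (γ : LoopClass {(wedgePolySmash K P).pt} t) :
    IsHomogeneous (killHom K P t) (List.finRange m) J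
      (LoopClass.pullback (toWedge K P J).toCont (toWedge K P J).mapsTo_pt γ) := by
  intro i _
  rcases J.eq_empty_or_nonempty with rfl | h
  · rw [pullback_toWedge_empty, map_one]
    exact ⟨fun _ => rfl, fun _ => rfl⟩
  · rw [pullback_toWedge K P h]
    exact ⟨fun hi => killHom_pullback_proj_of_mem hi _,
      fun hi => killHom_pullback_proj_of_notMem hi _⟩

/-- Loop families over the wedge correspond to loop families over the polyhedral product. -/
theorem polyProd.bijective_prod_pullback_toWedge (hP : ∀ i, (P i).IsNDR) :
    Function.Bijective fun γ : LoopClass {(wedgePolySmash K P).pt} t =>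
      ((List.finRange m).subsetList.map fun J =>
        LoopClass.pullback (toWedge K P J).toCont (toWedge K P J).mapsTo_pt γ).prod := by
  have hall : ∀ J : Finset (Fin m), J ⊆ (List.finRange m).toFinset := fun J i _ => by simp
  constructor
  · intro γ γ' h
    -- Unique factorization recovers each pullback along `toWedge` from the product; each of these
    -- determines the component on its wedge summand.
    have key := isHomogeneous_prod_unique (killHom K P t) (List.finRange m)
      (List.nodup_finRange m) _ _ (fun J _ => isHomogeneous_pullback_toWedge K P J γ)
      (fun J _ => isHomogeneous_pullback_toWedge K P J γ') h
    refine (loopClass_wedgePolySmash K P).1 (funext fun J => ?_)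
    have e := key J.1 (hall _)
    rw [pullback_toWedge K P J.2, pullback_toWedge K P J.2] at e
    exact (loopClass_polySmash fun i : J.1 => hP i).1 (pullback_proj_fat_injective hP J.1 e)
  · intro γ
    obtain ⟨c, -, hc, rfl⟩ := exists_isHomogeneous_prod (killHom K P t)
      (fun i j g => by
        simp only [killHom]
        rw [LoopClass.pullback_pullback _ _ _ _ (kill ({i} ∪ {j})) (mapsTo_kill _),
          LoopClass.pullback_pullback _ _ _ _ (kill ({i} ∪ {j})) (mapsTo_kill _)]
        · intro x
          rw [kill_kill]
        · intro x
          rw [kill_kill, Finset.union_comm])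
      (fun i g => by
        simp only [killHom]
        refine LoopClass.pullback_pullback _ _ _ _ _ _ (fun x => ?_) g
        rw [kill_kill, Finset.union_idempotent])
      (List.finRange m) (List.nodup_finRange m) ⊤ (fun _ _ _ _ => trivial) γ trivial
    -- The wedge has no summand for the empty set, and `toWedge` is constant there, so this factor
    -- has to be trivial.
    have hempty : c ∅ = 1 := eq_one_of_killHom_eq_self _ fun i =>
      (hc ∅ (hall _) i (List.mem_finRange i)).2 (Finset.notMem_empty i)
    choose d hd using fun J : {J : Finset (Fin m) // J.Nonempty} =>
      exists_pullback_proj_eq hP J.1 (c J.1)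
        (fun i hi => (hc J.1 (hall _) i (List.mem_finRange i)).1 hi)
        (fun i hi => (hc J.1 (hall _) i (List.mem_finRange i)).2 hi)
    choose e he using fun J : {J : Finset (Fin m) // J.Nonempty} =>
      (loopClass_polySmash fun i : J.1 => hP i).2 (d J)
    obtain ⟨γ, hγ⟩ := (loopClass_wedgePolySmash K P).2 e
    refine ⟨γ, congrArg List.prod (List.map_congr_left fun J _ => ?_)⟩
    rcases J.eq_empty_or_nonempty with rfl | h
    · rw [pullback_toWedge_empty, hempty]
    · rw [pullback_toWedge K P h, ← hd ⟨J, h⟩, ← he ⟨J, h⟩, ← congrFun hγ ⟨J, h⟩]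

end Splitting

theorem theorem3p2 (m : ℕ) (K : PreAbstractSimplicialComplex (Fin m)) :
    ∃ ε : ∀ P : Fin m → PtdPair.{u}, (∀ i, (P i).IsNDR) →
        PtdTop.Map (polyProd K P).susp (wedgePolySmash K P).susp,
      (∀ (P : Fin m → PtdPair.{u}) (hP : ∀ i, (P i).IsNDR), (ε P hP).IsHomotopyEquiv) ∧
      ∀ (P Q : Fin m → PtdPair.{u}) (hP : ∀ i, (P i).IsNDR) (hQ : ∀ i, (Q i).IsNDR)
        (f : ∀ i, PtdPair.Map (P i) (Q i)),
        (ε Q hQ).comp (PtdTop.suspMap (polyProdMap K f)) =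
          (PtdTop.suspMap (wedgePolySmashMap K f)).comp (ε P hP) := by
  -- The order of the summands depends only on m, so the same formula serves all collections and is
  -- strictly natural.
  refine ⟨fun P _ => PtdTop.suspSum (List.finRange m).subsetList (polyProd.toWedge K P),
    fun P hP => PtdTop.Map.isHomotopyEquiv_of_bijective _ ?_ ?_, fun P Q _ _ f =>
      PtdTop.suspSum_natural _ _ _ _ _ (polyProd.toWedge_natural K f)⟩
  · intro T φ
    obtain ⟨γ, hγ⟩ := (polyProd.bijective_prod_pullback_toWedge K P hP).2
      (LoopClass.mk (PtdTop.adjoint φ))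
    obtain ⟨ψ, rfl⟩ := LoopClass.mk_surjective γ
    refine ⟨PtdTop.ofLoopFamily ψ, PtdTop.homotopic_of_adjoint_equiv (LoopClass.mk_eq_mk.1 ?_)⟩
    rw [PtdTop.mk_adjoint_comp_suspSum, PtdTop.adjoint_ofLoopFamily]
    exact hγ
  · intro T g g' h
    have e := LoopClass.mk_eq_mk.2 (PtdTop.adjoint_equiv_of_homotopic h)
    rw [PtdTop.mk_adjoint_comp_suspSum, PtdTop.mk_adjoint_comp_suspSum] at e
    exact PtdTop.homotopic_of_adjoint_equiv (LoopClass.mk_eq_mk.1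
      ((polyProd.bijective_prod_pullback_toWedge K P hP).1 e))
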